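/- **Setting.** Let $d,n\ge 0$, let $C$ be a finite abelian group and $H=\mathbb R^n\times C$ (hypothesis H1). Let $\Gamma\subset H\times\mathbb R^d$ be a lattice (a discrete cocompact subgroup) such that the projection $H\times\mathbb R^d\to\mathbb R^d$ is injective on $\Gamma$ and the projection of $\Gamma$ to $H$ is dense. Let the window $W\subset H$ be a non-empty compact set that is the closure of its interior, such that $W+h=W$ only for $h=0$, and suppose that $W$ is a finite union of polyhedra (hypothesis H2). For $\xi\in (H\times\mathbb R^d)/\Gamma$ let $\Lambda_\xi(W)=\{x\in\mathbb R^d : (h,x)\in\Gamma+\xi \text{ for some } h\in W\}$; the parameter $\xi$ is non-singular if no $(h,x)\in\Gamma+\xi$ has $h\in\partial W$. The hull $\Omega_\Lambda$ of a point set $\Lambda\subset\mathbb R^d$ is the closure of $\{\Lambda+x : x\in\mathbb R^d\}$ in the local topology (two sets are close if their restrictions to a large ball around the origin are close in the Hausdorff sense). A model set with window $W$ is an element of the hull of some $\Lambda_\xi(W)$ with $\xi$ non-singular. For a model set $M$, the canonical transversal $\Xi_M\subset\Omega_M$ is the closure of $\{M-x : x\in M\}$, and $\pi_{max}$ denotes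 the factor map from $(\Omega_M,\mathbb R^d)$ onto its maximal equicontinuous factor. A function $F:M\to\mathbb R$ is *weakly pattern equivariant* if there is a continuous function $\tilde F:\Xi_M\to\mathbb R$ (necessarily unique) with $F(x)=\tilde F(M-x)$ for all $x\in M$. Its *coboundary* $\delta F(x,y)=F(y)-F(x)$, defined on the oriented edges $(x,y)$ of the Delaunay tiling of $\mathbb R^d$ with vertex set $M$, is *strongly pattern equivariant* if there is an $R>0$ such that $\delta F(x_1,y_1)=\delta F(x_2,y_2)$ for all edges with $y_1-x_1=y_2-x_2$ for which $M-x_1$ and $M-x_2$ agree on the ball of radius $R$ around the origin. **Theorem.** Let $M$ be a model set as above (satisfying H1 and H2), and let $F:M\to\mathbb R$ be a weakly pattern equivariant function whose coboundary is strongly pattern equivariant. Then $F$ is nonslip, that is: there is an $\epsilon>0$ such that for all $\Lambda_1,\Lambda_2\in\Xi_M$ with $\pi_{max}(\Lambda_1)=\pi_{max}(\Lambda_2)$ that agree on the ball of radius $\epsilon^{-1}$ around the origin, $\tilde F(\Lambda_1)=\tilde F(\Lambda_2)$. -/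

import Mathlib

open scoped Pointwise

/-- The Euclidean space of dimension `d`. -/
abbrev Space (d : ℕ) : Type := EuclideanSpace ℝ (Fin d)

/-! ### The space of point patterns -/

/-- `A` and `B` agree inside the ball of radius `R` about the origin up to moving points by at
most `ε`: each point of one of the sets in that ball is `ε`-close to a point of the other set. -/
def localEntourage (d : ℕ) (R ε : ℝ) : Set (Set (Space d) × Set (Space d)) :=
  {p | (∀ a ∈ p.1, ‖a‖ ≤ R → ∃ b ∈ p.2, dist a b ≤ ε) ∧
       (∀ b ∈ p.2, ‖b‖ ≤ R → ∃ a ∈ p.1, dist b a ≤ ε)}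

theorem localEntourage_mono {d : ℕ} {R R' ε ε' : ℝ} (hR : R' ≤ R) (hε : ε ≤ ε') :
    localEntourage d R ε ⊆ localEntourage d R' ε' := by
  rintro ⟨A, B⟩ ⟨h₁, h₂⟩
  refine ⟨fun a ha hn => ?_, fun b hb hn => ?_⟩
  · obtain ⟨b, hb, h⟩ := h₁ a ha (hn.trans hR)
    exact ⟨b, hb, h.trans hε⟩
  · obtain ⟨a, ha, h⟩ := h₂ b hb (hn.trans hR)
    exact ⟨a, ha, h.trans hε⟩

/-- The basis of entourages `localEntourage d R ε`, `ε > 0`. -/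
def localBasis (d : ℕ) : FilterBasis (Set (Space d) × Set (Space d)) where
  sets := {U | ∃ R ε : ℝ, 0 < ε ∧ U = localEntourage d R ε}
  nonempty := ⟨_, 0, 1, one_pos, rfl⟩
  inter_sets := by
    rintro _ _ ⟨R, ε, hε, rfl⟩ ⟨R', ε', hε', rfl⟩
    exact ⟨_, ⟨max R R', min ε ε', lt_min hε hε', rfl⟩, Set.subset_inter
      (localEntourage_mono (le_max_left _ _) (min_le_left _ _))
      (localEntourage_mono (le_max_right _ _) (min_le_right _ _))⟩

/-- The local topology on point patterns: two patterns are close if their restrictions to a large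
ball around the origin are close in the Hausdorff sense. (A set in the closure, with respect to
this topology, of a family of Delone sets with common inner and outer radii is again a Delone set
with these radii, and on such sets the topology is Hausdorff.) -/
instance patternUniformSpace (d : ℕ) : UniformSpace (Set (Space d)) :=
  UniformSpace.ofCore <| UniformSpace.Core.mkOfBasis (localBasis d)
    (by
      rintro _ ⟨R, ε, hε, rfl⟩ A
      exact ⟨fun a ha _ => ⟨a, ha, by simpa using hε.le⟩,
        fun a ha _ => ⟨a, ha, by simpa using hε.le⟩⟩)
    (by
      rintro _ ⟨R, ε, hε, rfl⟩
      exact ⟨_, ⟨R, ε, hε, rfl⟩, fun p hp => ⟨hp.2, hp.1⟩⟩)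
    (by
      rintro _ ⟨R, ε, hε, rfl⟩
      refine ⟨_, ⟨R + ε, ε / 2, by positivity, rfl⟩, ?_⟩
      have key : ∀ a b : Space d, ‖a‖ ≤ R → dist a b ≤ ε / 2 → ‖b‖ ≤ R + ε := by
        intro a b ha hab
        have h := norm_le_norm_add_norm_sub' b a
        rw [← dist_eq_norm, dist_comm] at h
        linarith
      rintro ⟨A, B⟩ ⟨D, hAD, hDB⟩
      refine ⟨fun a ha hn => ?_, fun b hb hn => ?_⟩
      · obtain ⟨c, hc, hac⟩ := hAD.1 a ha (by linarith)
        obtain ⟨b, hb, hcb⟩ := hDB.1 c hc (key a c hn hac)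
        exact ⟨b, hb, by linarith [dist_triangle a c b]⟩
      · obtain ⟨c, hc, hbc⟩ := hDB.2 b hb (by linarith)
        obtain ⟨a, ha, hca⟩ := hAD.2 c hc (key b c hn hbc)
        exact ⟨a, ha, by linarith [dist_triangle b c a]⟩)

/-- Two patterns agree (exactly) on the closed ball of radius `R` around the origin. -/
def AgreeOn {d : ℕ} (R : ℝ) (A B : Set (Space d)) : Prop :=
  A ∩ Metric.closedBall 0 R = B ∩ Metric.closedBall 0 R

/-- The continuous hull `Ω_Λ`: the closure of the set of all translates of `Λ`. -/
def hull {d : ℕ} (Λ : Set (Space d)) : Set (Set (Space d)) :=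
  closure {A | ∃ x : Space d, A = x +ᵥ Λ}

/-- The canonical transversal `Ξ_Λ`: the closure of `{Λ - x | x ∈ Λ}`. -/
def transversal {d : ℕ} (Λ : Set (Space d)) : Set (Set (Space d)) :=
  closure {A | ∃ x ∈ Λ, A = (-x) +ᵥ Λ}

/-- The relation `π_max Λ₁ = π_max Λ₂` on the hull of `Λ`, where `π_max` is the maximal equicontinuous
factor map of the dynamical system `(Ω_Λ, ℝ^d)`: the two patterns have the same image under every
factor map onto a compact Hausdorff space on which `ℝ^d` acts equicontinuously. -/
def MaxEquicontinuousRel {d : ℕ} (Λ Λ₁ Λ₂ : Set (Space d)) : Prop :=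
  ∃ (h₁ : Λ₁ ∈ hull Λ) (h₂ : Λ₂ ∈ hull Λ),
    ∀ (Y : Type) [UniformSpace Y] [CompactSpace Y] [T2Space Y]
      [AddAction (Space d) Y] [ContinuousVAdd (Space d) Y] (p : hull Λ → Y),
      Continuous p → Function.Surjective p →
      (∀ (x : Space d) (A B : hull Λ), (B : Set (Space d)) = x +ᵥ (A : Set (Space d)) →
        p B = x +ᵥ p A) →
      UniformEquicontinuous (fun (x : Space d) (y : Y) => x +ᵥ y) →
      p ⟨Λ₁, h₁⟩ = p ⟨Λ₂, h₂⟩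

/-! ### Pattern equivariance -/

/-- `G` is a continuous function on the transversal of `Λ` with `F x = G (Λ - x)` for `x ∈ Λ`.
Such a `G` is unique, because the patterns `Λ - x` are dense in the transversal. -/
def IsTransversalExtension {d : ℕ} (Λ : Set (Space d)) (F : Λ → ℝ) (G : transversal Λ → ℝ) :
    Prop :=
  Continuous G ∧
    ∀ x : Λ, F x = G ⟨(-(x : Space d)) +ᵥ Λ, subset_closure ⟨x, x.2, rfl⟩⟩

/-- Weakly pattern equivariant functions on `Λ`. -/
def WeaklyPatternEquivariant {d : ℕ} (Λ : Set (Space d)) (F : Λ → ℝ) : Prop :=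
  ∃ G : transversal Λ → ℝ, IsTransversalExtension Λ F G

/-- The edges (1-cells) of the Delaunay tiling of `Λ`, a polyhedral tiling with vertex set `Λ`
that is determined locally by `Λ`: `x` and `y` span an edge if there is a point `c` whose nearest
points in `Λ` are exactly `x` and `y`. -/
def IsEdge {d : ℕ} (Λ : Set (Space d)) (x y : Space d) : Prop :=
  x ∈ Λ ∧ y ∈ Λ ∧ x ≠ y ∧
    ∃ c : Space d, dist c x = dist c y ∧ ∀ z ∈ Λ, z ≠ x → z ≠ y → dist c x < dist c z

/-- The coboundary `δF`, a function on pairs of points of `Λ` (in particular on oriented edges). -/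
def coboundary {d : ℕ} {Λ : Set (Space d)} (F : Λ → ℝ) (x y : Λ) : ℝ := F y - F x

/-- A function on oriented edges (a 1-cochain) is strongly pattern equivariant if, for some radius
`R`, it takes the same value on any two edges that are translates of each other and around which
the patterns agree (up to that translation) out to distance `R`. -/
def StronglyPatternEquivariantOnEdges {d : ℕ} (Λ : Set (Space d)) (φ : Λ → Λ → ℝ) : Prop :=
  ∃ R : ℝ, 0 < R ∧ ∀ x₁ y₁ x₂ y₂ : Λ,
    IsEdge Λ x₁ y₁ → IsEdge Λ x₂ y₂ → (y₁ : Space d) - x₁ = y₂ - x₂ →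
    AgreeOn R ((-(x₁ : Space d)) +ᵥ Λ) ((-(x₂ : Space d)) +ᵥ Λ) → φ x₁ y₁ = φ x₂ y₂

/-- A function `F` on `Λ` is nonslip: it is weakly pattern equivariant and its continuous extension
`G` to the transversal takes the same value on any two patterns with the same image in the maximal
equicontinuous factor that agree out to the radius `ε⁻¹`. -/
def Nonslip {d : ℕ} (Λ : Set (Space d)) (F : Λ → ℝ) : Prop :=
  ∃ G : transversal Λ → ℝ, IsTransversalExtension Λ F G ∧
    ∃ ε : ℝ, 0 < ε ∧ ∀ Λ₁ Λ₂ : transversal Λ,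
      MaxEquicontinuousRel Λ Λ₁ Λ₂ → AgreeOn ε⁻¹ (Λ₁ : Set (Space d)) Λ₂ → G Λ₁ = G Λ₂

/-! ### Model sets -/

/-- A cut and project scheme `(Γ, H, ℝ^d)`. -/
structure CutProjectScheme (d : ℕ) (H : Type*) [AddCommGroup H] [TopologicalSpace H] where
  /-- The lattice. -/
  lattice : AddSubgroup (H × Space d)
  discrete : DiscreteTopology lattice
  cocompact : CompactSpace ((H × Space d) ⧸ lattice)
  injective : Set.InjOn Prod.snd (lattice : Set (H × Space d))
  dense : Dense (Prod.fst '' (lattice : Set (H × Space d)))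

namespace CutProjectScheme

variable {d : ℕ} {H : Type*} [AddCommGroup H] [TopologicalSpace H]

/-- The projection set with window `W` and parameter `ξ ∈ (H × ℝ^d) / Γ`: the set of all `x` such
that `(h, x) ∈ Γ + ξ` for some `h ∈ W`. -/
def projectionSet (S : CutProjectScheme d H) (W : Set H) (ξ : (H × Space d) ⧸ S.lattice) :
    Set (Space d) :=
  {x | ∃ h ∈ W, ((h, x) : (H × Space d) ⧸ S.lattice) = ξ}

/-- `ξ` is non-singular: the projection of `Γ + ξ` to `H` does not meet the boundary of `W`. -/
def IsNonsingular (S : CutProjectScheme d H) (W : Set H) (ξ : (H × Space d) ⧸ S.lattice) : Prop :=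
  ∀ (h : H) (x : Space d), ((h, x) : (H × Space d) ⧸ S.lattice) = ξ → h ∉ frontier W

/-- A model set with window `W`: an element of the hull of a projection set with window `W` and
non-singular parameter. -/
def IsModelSet (S : CutProjectScheme d H) (W : Set H) (M : Set (Space d)) : Prop :=
  ∃ ξ : (H × Space d) ⧸ S.lattice, S.IsNonsingular W ξ ∧ M ∈ hull (S.projectionSet W ξ)

end CutProjectScheme

/-- The standing assumptions on a window: it is compact, non-empty, the closure of its interior,
and has no non-trivial translational symmetry. -/
structure IsWindow {H : Type*} [AddCommGroup H] [TopologicalSpace H] (W : Set H) : Prop where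
  isCompact : IsCompact W
  nonempty : W.Nonempty
  closure_interior : closure (interior W) = W
  aperiodic : ∀ h : H, h +ᵥ W = W → h = 0

/-- A convex polyhedron: an intersection of finitely many closed half-spaces. -/
def IsConvexPolyhedron {n : ℕ} (P : Set (Space n)) : Prop :=
  ∃ s : Finset (Space n × ℝ), P = {v | ∀ p ∈ s, inner ℝ p.1 v ≤ p.2}

/-- `W ⊆ ℝ^n × C` is a finite union of polyhedra. (Each polyhedron lies in one sheet
`ℝ^n × {c}`; a polyhedron that is not convex is a finite union of convex ones.) -/
def IsPolyhedral {n : ℕ} {C : Type*} (W : Set (Space n × C)) : Prop :=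
  ∃ Q : Set (Set (Space n) × C), Q.Finite ∧ (∀ q ∈ Q, IsConvexPolyhedron q.1) ∧
    W = ⋃ q ∈ Q, q.1 ×ˢ {q.2}

open scoped Pointwise Uniformity
open Filter Topology

/-! ### Generic points -/

/-! The transversal is explicit. Write `W` as a finite union of convex polyhedra. For a direction
`u` parallel to no bounding hyperplane, `sided Q u` is the window in which each boundary point is
kept or dropped according to where `u` points from it. The transversal consists exactly of the
patterns cut out by `sided Q u` at an internal parameter `h ∈ sided Q u` (`transversal_eq`). The
torus parameter is a continuous equivariant map from the hull onto an equicontinuous system, so two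
elements with the same `π_max` have the same `h` (`eq_of_maxEquicontinuousRel`). They differ only in
the direction, hence only at points whose internal coordinate lies on a facet.

Such points are confined. For a fixed normal `v` they lie in a slab of `ℝ^d` of bounded width
(`exists_slab`). Otherwise the lattice points with internal coordinate orthogonal to `v` would span
all of `ℝ^d`, and then `⟪v, ·⟫` would take only finitely many values on lattice points with bounded
internal coordinate, contradicting density.

Let `g` be the continuous extension of `F` to the transversal. Its increments along Delaunay edges
are locally determined (`exists_hasLocalIncrements`). So the difference of `g` at two patterns `A`,
`B` is unchanged when the origin moves along a path near which they agree
(`exists_sub_eq_of_segment`). If `A` and `B` differ only in one slab and the origin is far from it,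
one walks away from the slab: they agree on ever larger balls, the difference tends to `0` by
uniform continuity, and being constant it is `0` (`exists_forall_far_eq`).

For general directions `u`, `u'`, one passes from one to the other crossing one family of parallel
hyperplanes at a time (`eq_of_forall_far`). The intermediate patterns may differ from `A` and `B`
near the origin, so one first moves to a point at bounded distance that is far from all of the
finitely many slabs (`exists_far_point`). Agreement of `A` and `B` on a large enough ball allows
this move, and this fixes `ε`. -/

theorem exists_mem_forall_inner_ne {E : Type*} [NormedAddCommGroup E] [InnerProductSpace ℝ E]
    {s : Set (E × ℝ)} (hs : s.Finite) (h0 : ∀ p ∈ s, p.1 ≠ 0) {O : Set E} (hO : IsOpen O)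
    (hne : O.Nonempty) : ∃ w ∈ O, ∀ p ∈ s, inner ℝ p.1 w ≠ p.2 := by
  induction s, hs using Set.Finite.induction_on generalizing O with
  | empty => exact ⟨hne.some, hne.some_mem, by simp⟩
  | @insert a s ha hs ih =>
    have hcont : Continuous fun w : E => inner ℝ a.1 w := by fun_prop
    have hO' : IsOpen (O ∩ {w | inner ℝ a.1 w ≠ a.2}) :=
      hO.inter (isOpen_ne_fun hcont continuous_const)
    have hne' : (O ∩ {w | inner ℝ a.1 w ≠ a.2}).Nonempty := by
      obtain ⟨w, hw⟩ := hne
      by_cases hwa : inner ℝ a.1 w = a.2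
      · have hc : Continuous fun t : ℝ => w + t • a.1 := by fun_prop
        have hmem : (fun t : ℝ => w + t • a.1) ⁻¹' O ∈ nhds (0 : ℝ) :=
          hc.continuousAt.preimage_mem_nhds (by simpa using hO.mem_nhds hw)
        obtain ⟨δ, hδ, hball⟩ := Metric.mem_nhds_iff.1 hmem
        have hin : δ / 2 ∈ Metric.ball (0 : ℝ) δ := by
          rw [Metric.mem_ball, Real.dist_eq, sub_zero, abs_of_pos (by positivity)]
          linarith
        -- Moving along the normal changes the inner product by `δ / 2 * ‖a.1‖ ^ 2`, which is not
        -- zero.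
        refine ⟨w + (δ / 2) • a.1, hball hin, ?_⟩
        have ha0 : inner ℝ a.1 a.1 ≠ (0 : ℝ) := inner_self_ne_zero.2 (h0 a (by simp))
        simp only [Set.mem_ofPred_eq, inner_add_right, inner_smul_right, hwa]
        intro h
        have : δ / 2 * inner ℝ a.1 a.1 = 0 := by linarith
        rcases mul_eq_zero.1 this with h | h
        · linarith
        · exact ha0 h
      · exact ⟨w, hw, hwa⟩
    obtain ⟨w, hw, h⟩ := ih (fun p hp => h0 p (Set.mem_insert_of_mem _ hp)) hO' hne'
    refine ⟨w, hw.1, ?_⟩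
    rintro p (rfl | hp)
    · exact hw.2
    · exact h p hp

/-! ### Edges of the Delaunay tiling -/

theorem IsEdge.vadd {d : ℕ} {Λ : Set (Space d)} {x y : Space d} (h : IsEdge Λ x y)
    (v : Space d) : IsEdge (v +ᵥ Λ) (v + x) (v + y) := by
  obtain ⟨hx, hy, hne, c, hc, hlt⟩ := h
  refine ⟨Set.vadd_mem_vadd_set hx, Set.vadd_mem_vadd_set hy, by simpa using hne, v + c,
    by simpa using hc, ?_⟩
  rintro _ ⟨z, hz, rfl⟩ hzx hzy
  simp only [vadd_eq_add, dist_add_left] at *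
  exact hlt z hz (fun h => hzx (by rw [h])) (fun h => hzy (by rw [h]))

theorem IsEdge.dist_le {d : ℕ} {Λ : Set (Space d)} {x y : Space d} {ρ : ℝ} (h : IsEdge Λ x y)
    (hρ : ∀ c : Space d, ∃ z ∈ Λ, dist c z ≤ ρ) : dist x y ≤ 2 * ρ := by
  obtain ⟨hx, hy, hne, c, hc, hlt⟩ := h
  obtain ⟨z, hz, hcz⟩ := hρ c
  have hcx : dist c x ≤ ρ := by
    by_cases h1 : z = x
    · rwa [← h1]
    by_cases h2 : z = y
    · rwa [hc, ← h2]
    exact (hlt z hz h1 h2).le.trans hcz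
  linarith [dist_triangle_left x y c]

/-- The centre witnessing the edge is within `ρ` of `x`, so any point that could compete with `x` is
within `2 * ρ` of `x`: edges are determined locally. -/
theorem IsEdge.of_agree {d : ℕ} {Λ Λ' : Set (Space d)} {x y : Space d} {ρ : ℝ}
    (h : IsEdge Λ x y) (hρ : ∀ c : Space d, ∃ z ∈ Λ, dist c z ≤ ρ)
    (hag : ∀ z, dist z x ≤ 2 * ρ → (z ∈ Λ ↔ z ∈ Λ')) : IsEdge Λ' x y := by
  have hd := h.dist_le hρ
  obtain ⟨hx, hy, hne, c, hc, hlt⟩ := h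
  have hρ0 : 0 ≤ ρ := by
    obtain ⟨z, -, hz⟩ := hρ 0
    exact dist_nonneg.trans hz
  have hcx : dist c x ≤ ρ := by
    obtain ⟨z, hz, hcz⟩ := hρ c
    by_cases h1 : z = x
    · rwa [← h1]
    by_cases h2 : z = y
    · rwa [hc, ← h2]
    exact (hlt z hz h1 h2).le.trans hcz
  refine ⟨(hag x (by simpa using hρ0)).1 hx, (hag y (by rwa [dist_comm])).1 hy, hne, c, hc, ?_⟩
  intro z hz hzx hzy
  by_contra hcon
  push Not at hcon
  have hzd : dist z x ≤ 2 * ρ := by linarith [dist_triangle_left z x c]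
  exact absurd (hlt z ((hag z hzd).2 hz) hzx hzy) (not_lt.2 hcon)

/-- From a point `x` of a locally finite set there is an edge that gets closer to a given point. -/
theorem exists_isEdge_dist_lt {d : ℕ} {Λ : Set (Space d)}
    (hfin : ∀ K : ℝ, (Λ ∩ Metric.closedBall 0 K).Finite) {x y : Space d} (hx : x ∈ Λ)
    (hy : y ∈ Λ) (hxy : x ≠ y) : ∃ z, IsEdge Λ x z ∧ dist z y < dist x y := by
  have hfin' : ∀ K : ℝ, {z | z ∈ Λ ∧ dist z y ≤ K}.Finite := fun K =>
    (hfin (K + ‖y‖)).subset fun z hz => ⟨hz.1, by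
      have := norm_le_norm_add_norm_sub' z y
      rw [← dist_eq_norm] at this
      rw [mem_closedBall_zero_iff]
      linarith [hz.2]⟩
  -- `f z v` is the squared distance from `x + v` to `z` minus that to `x`, and it is affine in `v`.
  -- A centre moves from `x + v`, with `v` small and generic, straight to `y`; the first point of
  -- `Λ` to come as close to it as `x` is the other end of the edge.
  set f : Space d → Space d → ℝ := fun z v => ‖z - x‖ ^ 2 - 2 * inner ℝ v (z - x) with hf
  have hfd : ∀ z v : Space d, dist (x + v) z ^ 2 = dist (x + v) x ^ 2 + f z v := by
    intro z v
    have h1 : x + v - z = v - (z - x) := by abel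
    rw [dist_eq_norm, dist_eq_norm, h1, add_sub_cancel_left, norm_sub_sq_real, hf]
    ring
  set η := y - x with hη
  have hxη : x + η = y := by rw [hη]; abel
  have hyd : ∀ z, dist z y < dist x y ↔ f z η < 0 := by
    intro z
    have := hfd z η
    rw [hxη, dist_comm y z, dist_comm y x] at this
    constructor
    · intro h
      have := pow_lt_pow_left₀ h dist_nonneg two_ne_zero
      linarith
    · intro h
      exact lt_of_pow_lt_pow_left₀ 2 dist_nonneg (by linarith)
  -- a radius in which `x` is the nearest point
  obtain ⟨δ, hδ, hδz⟩ : ∃ δ : ℝ, 0 < δ ∧ ∀ z ∈ Λ, z ≠ x → 2 * δ ≤ ‖z - x‖ := by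
    have hA : {z | z ∈ Λ ∧ dist z y ≤ dist x y + 1 ∧ z ≠ x}.Finite :=
      (hfin' (dist x y + 1)).subset fun z hz => ⟨hz.1, hz.2.1⟩
    rcases Set.eq_empty_or_nonempty {z | z ∈ Λ ∧ dist z y ≤ dist x y + 1 ∧ z ≠ x} with he | hne
    · refine ⟨1 / 2, by norm_num, fun z hz hzx => ?_⟩
      by_contra hcon
      push Not at hcon
      have : z ∈ {z | z ∈ Λ ∧ dist z y ≤ dist x y + 1 ∧ z ≠ x} := by
        refine ⟨hz, ?_, hzx⟩
        have := dist_triangle z x y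
        rw [dist_eq_norm z x] at this
        linarith
      rw [he] at this
      exact this
    · obtain ⟨z0, hz0, hmin⟩ := Set.exists_min_image _ (fun z => ‖z - x‖) hA hne
      have hpos : 0 < ‖z0 - x‖ := norm_pos_iff.2 (sub_ne_zero.2 hz0.2.2)
      refine ⟨min (1 / 2) (‖z0 - x‖ / 2), by positivity, fun z hz hzx => ?_⟩
      by_cases hzy : dist z y ≤ dist x y + 1
      · have := hmin z ⟨hz, hzy, hzx⟩
        have h2 := min_le_right (1 / 2 : ℝ) (‖z0 - x‖ / 2)
        linarith
      · have := dist_triangle z x y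
        rw [dist_eq_norm z x] at this
        have h2 := min_le_left (1 / 2 : ℝ) (‖z0 - x‖ / 2)
        linarith
  have hpos : ∀ v, ‖v‖ < δ → ∀ z ∈ Λ, z ≠ x → 0 < f z v := by
    intro v hv z hz hzx
    have h1 := hδz z hz hzx
    have h2 : inner ℝ v (z - x) ≤ ‖v‖ * ‖z - x‖ := real_inner_le_norm _ _
    have h3 : ‖v‖ * ‖z - x‖ < δ * ‖z - x‖ := by
      apply mul_lt_mul_of_pos_right hv
      linarith
    have h4 : 2 * δ * ‖z - x‖ ≤ ‖z - x‖ * ‖z - x‖ :=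
      mul_le_mul_of_nonneg_right h1 (norm_nonneg _)
    simp only [hf]
    nlinarith
  set Z : Set (Space d) := {z | z ∈ Λ ∧ f z η < 0} with hZ
  have hZfin : Z.Finite := (hfin' (dist x y)).subset fun z hz => ⟨hz.1, ((hyd z).2 hz.2).le⟩
  have hyZ : y ∈ Z := by
    refine ⟨hy, (hyd y).1 ?_⟩
    rw [dist_self]
    exact dist_pos.2 hxy
  have hZx : ∀ z ∈ Z, z ≠ x := by
    rintro z hz rfl
    exact lt_irrefl _ ((hyd z).2 hz.2)
  -- Two points of `Z` reach equality with `x` at the same time exactly when `v` lies on one of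
  -- these hyperplanes; avoiding them makes the first hit unique. If a normal vanished, `z - x` and
  -- `z' - x` would be proportional with ratio `f z η : f z' η`; comparing inner products with `η`
  -- and norms gives `z = z'`.
  obtain ⟨v, hv, hgen⟩ := exists_mem_forall_inner_ne
    (s := (fun q : Space d × Space d => (f q.2 η • (q.1 - x) - f q.1 η • (q.2 - x),
      (‖q.1 - x‖ ^ 2 * f q.2 η - ‖q.2 - x‖ ^ 2 * f q.1 η) / 2)) ''
        ((Z ×ˢ Z) ∩ {q | q.1 ≠ q.2}))
    (((hZfin.prod hZfin).inter_of_left _).image _)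
    (by
      rintro _ ⟨⟨z, z'⟩, ⟨⟨hz, hz'⟩, hne⟩, rfl⟩ h0
      simp only [Set.mem_ofPred_eq] at hne hz hz' h0
      have h1 : f z' η • (z - x) = f z η • (z' - x) := sub_eq_zero.1 h0
      have h2 : f z' η * inner ℝ η (z - x) = f z η * inner ℝ η (z' - x) := by
        simpa [inner_smul_right] using congrArg (fun t => inner ℝ η t) h1
      have h3 : f z' η ^ 2 * ‖z - x‖ ^ 2 = f z η ^ 2 * ‖z' - x‖ ^ 2 := by
        have := congrArg (fun t => ‖t‖ ^ 2) h1
        simpa [norm_smul, mul_pow] using this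
      have h4 : f z η = ‖z - x‖ ^ 2 - 2 * inner ℝ η (z - x) := rfl
      have h5 : f z' η = ‖z' - x‖ ^ 2 - 2 * inner ℝ η (z' - x) := rfl
      have h6 : f z' η * ‖z - x‖ ^ 2 = f z η * ‖z' - x‖ ^ 2 := by
        linear_combination f z η * h5 - f z' η * h4 + 2 * h2
      have h7 : f z η * ‖z' - x‖ ^ 2 * (f z' η - f z η) = 0 := by
        linear_combination h3 - f z' η * h6
      have h8 : ‖z' - x‖ ^ 2 ≠ 0 := pow_ne_zero 2 (norm_ne_zero_iff.2 (sub_ne_zero.2 (hZx z' hz')))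
      have h9 : f z η = f z' η := by
        rcases mul_eq_zero.1 h7 with h | h
        · exact absurd h (mul_ne_zero hz.2.ne h8)
        · linarith
      rw [h9] at h1
      exact hne (sub_left_injective (smul_right_injective _ hz'.2.ne h1)))
    (O := Metric.ball 0 δ) Metric.isOpen_ball ⟨0, Metric.mem_ball_self hδ⟩
  rw [mem_ball_zero_iff] at hv
  -- The time at which the moving centre is equidistant from `x` and `z`.
  set τ : Space d → ℝ := fun z => f z v / (f z v - f z η) with hτ
  obtain ⟨z, hz, hmin⟩ := Set.exists_min_image Z τ hZfin ⟨y, hyZ⟩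
  have hτpos : ∀ z ∈ Z, 0 < f z v - f z η := fun z hz => by
    have := hpos v hv z hz.1 (hZx z hz)
    have := hz.2
    linarith
  have hφ : ∀ (z : Space d) (t : ℝ), f z (v + t • (η - v)) = (1 - t) * f z v + t * f z η := by
    intro z t
    simp only [hf, inner_add_left, inner_smul_left, inner_sub_left]
    simp
    ring
  have hzt : f z (v + τ z • (η - v)) = 0 := by
    rw [hφ]
    have : τ z * (f z v - f z η) = f z v := div_mul_cancel₀ _ (hτpos z hz).ne'
    linarith
  have ht0 : 0 < τ z := div_pos (hpos v hv z hz.1 (hZx z hz)) (hτpos z hz)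
  have ht1 : τ z < 1 := by
    rw [hτ, div_lt_one (hτpos z hz)]
    linarith [hz.2]
  refine ⟨z, ⟨hx, hz.1, (hZx z hz).symm, x + (v + τ z • (η - v)), ?_, ?_⟩, (hyd z).2 hz.2⟩
  · have := hfd z (v + τ z • (η - v))
    rw [hzt, add_zero] at this
    exact ((sq_eq_sq₀ dist_nonneg dist_nonneg).1 this).symm
  · intro z' hz' hz'x hz'z
    have key : 0 < f z' (v + τ z • (η - v)) := by
      rw [hφ]
      have hp := hpos v hv z' hz' hz'x
      by_cases h : f z' η < 0
      · have hz'Z : z' ∈ Z := ⟨hz', h⟩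
        have hle := hmin z' hz'Z
        have hlt : τ z < τ z' := by
          refine lt_of_le_of_ne hle fun heq => ?_
          have := hgen _ ⟨(z, z'), ⟨⟨hz, hz'Z⟩, hz'z.symm⟩, rfl⟩
          apply this
          simp only [hτ] at heq
          rw [div_eq_div_iff (hτpos z hz).ne' (hτpos z' hz'Z).ne'] at heq
          have e1 : f z v = ‖z - x‖ ^ 2 - 2 * inner ℝ v (z - x) := rfl
          have e2 : f z' v = ‖z' - x‖ ^ 2 - 2 * inner ℝ v (z' - x) := rfl
          change inner ℝ (f z' η • (z - x) - f z η • (z' - x)) v =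
            (‖z - x‖ ^ 2 * f z' η - ‖z' - x‖ ^ 2 * f z η) / 2
          rw [inner_sub_left, inner_smul_left, inner_smul_left, real_inner_comm v (z - x),
            real_inner_comm v (z' - x)]
          simp only [conj_trivial]
          linear_combination (1 / 2) * heq + (f z' η / 2) * e1 - (f z η / 2) * e2
        have h5 : τ z' * (f z' v - f z' η) = f z' v := div_mul_cancel₀ _ (hτpos z' hz'Z).ne'
        have := mul_lt_mul_of_pos_right hlt (hτpos z' hz'Z)
        linarith
      · push Not at h
        have := mul_pos (sub_pos.2 ht1) hp
        have := mul_nonneg ht0.le h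
        linarith
    have := hfd z' (v + τ z • (η - v))
    exact lt_of_pow_lt_pow_left₀ 2 dist_nonneg (by linarith)

/-! ### Polyhedral windows seen from a direction -/

/-- The points `v` that satisfy `⟪p.1, v + s • u⟫ ≤ p.2` for all small `s > 0`. -/
def HalfSpaceCond {n : ℕ} (p : Space n × ℝ) (u v : Space n) : Prop :=
  inner ℝ p.1 v < p.2 ∨ (inner ℝ p.1 v = p.2 ∧ inner ℝ p.1 u ≤ 0)

/-- The points `h` such that `h + s • u` lies for all small `s > 0` in the union of the polyhedra
given by `Q`; for `u = 0` this is the union itself. -/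
def sided {n : ℕ} {C : Type*} (Q : Set (Finset (Space n × ℝ) × C)) (u : Space n) :
    Set (Space n × C) :=
  {h | ∃ q ∈ Q, h.2 = q.2 ∧ ∀ p ∈ q.1, HalfSpaceCond p u h.1}

/-- All the half-spaces that occur in `Q`. -/
def halfSpaces {n : ℕ} {C : Type*} (Q : Set (Finset (Space n × ℝ) × C)) : Set (Space n × ℝ) :=
  {p | ∃ q ∈ Q, p ∈ q.1}

/-- `u` is not parallel to any of the facets. -/
def IsGeneric {n : ℕ} {C : Type*} (Q : Set (Finset (Space n × ℝ) × C)) (u : Space n) : Prop :=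
  ∀ p ∈ halfSpaces Q, p.1 ≠ 0 → inner ℝ p.1 u ≠ (0 : ℝ)

section Sided

variable {n : ℕ} {C : Type*} {Q : Set (Finset (Space n × ℝ) × C)}

theorem IsPolyhedral.exists_sided {W : Set (Space n × C)} (h : IsPolyhedral W) :
    ∃ Q : Set (Finset (Space n × ℝ) × C), Q.Finite ∧ W = sided Q 0 := by
  obtain ⟨Q, hQ, hP, rfl⟩ := h
  choose! s hs using hP
  refine ⟨(fun q => (s q, q.2)) '' Q, hQ.image _, ?_⟩
  ext ⟨v, c⟩
  simp only [Set.mem_iUnion, Set.mem_prod, Set.mem_singleton_iff, exists_prop, sided,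
    Set.mem_ofPred_eq, Set.exists_mem_image, HalfSpaceCond, inner_zero_right, le_refl, and_true]
  refine exists_congr fun q => and_congr_right fun hq => ?_
  rw [and_comm, hs q hq]
  simp only [Set.mem_ofPred_eq, le_iff_lt_or_eq]

theorem finite_halfSpaces (hQ : Q.Finite) : (halfSpaces Q).Finite := by
  have : halfSpaces Q = ⋃ q ∈ Q, (q.1 : Set (Space n × ℝ)) := by
    ext p
    simp [halfSpaces]
  rw [this]
  exact hQ.biUnion fun q _ => q.1.finite_toSet

theorem sided_subset (u : Space n) : sided Q u ⊆ sided Q 0 := by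
  rintro h ⟨q, hq, hc, hp⟩
  exact ⟨q, hq, hc, fun p hpq => (hp p hpq).imp id fun h => ⟨h.1, by simp⟩⟩

theorem sided_congr {u u' : Space n} {h h' : Space n × C} (hc : h.2 = h'.2)
    (H : ∀ p ∈ halfSpaces Q, HalfSpaceCond p u h.1 ↔ HalfSpaceCond p u' h'.1) :
    h ∈ sided Q u ↔ h' ∈ sided Q u' := by
  refine exists_congr fun q => and_congr_right fun hq => ?_
  rw [hc]
  exact and_congr_right fun _ => forall₂_congr fun p hp => H p ⟨q, hq, hp⟩

theorem sided_eq_of_sign {u u' : Space n}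
    (H : ∀ p ∈ halfSpaces Q, p.1 ≠ 0 → (inner ℝ p.1 u ≤ 0 ↔ inner ℝ p.1 u' ≤ (0 : ℝ))) :
    sided Q u = sided Q u' := by
  ext h
  refine sided_congr rfl fun p hp => ?_
  by_cases h0 : p.1 = 0
  · simp [HalfSpaceCond, h0]
  · simp only [HalfSpaceCond, H p hp h0]

theorem exists_halfSpace_of_mem_of_notMem {u u' : Space n} {h : Space n × C}
    (h1 : h ∈ sided Q u) (h2 : h ∉ sided Q u') :
    ∃ p ∈ halfSpaces Q, p.1 ≠ 0 ∧ inner ℝ p.1 h.1 = p.2 ∧ inner ℝ p.1 u ≤ (0 : ℝ) ∧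
      0 < (inner ℝ p.1 u' : ℝ) := by
  obtain ⟨q, hq, hc, hp⟩ := h1
  by_contra hcon
  push Not at hcon
  refine h2 ⟨q, hq, hc, fun p hpq => ?_⟩
  rcases hp p hpq with h | ⟨h, hu⟩
  · exact Or.inl h
  · refine Or.inr ⟨h, ?_⟩
    by_cases h0 : p.1 = 0
    · simp [h0]
    · exact hcon p ⟨q, hq, hpq⟩ h0 h hu

theorem exists_isGeneric_sub (hQ : Q.Finite) (a : Space n) {O : Set (Space n)} (hO : IsOpen O)
    (hne : O.Nonempty) : ∃ u ∈ O, IsGeneric Q (u - a) := by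
  obtain ⟨u, hu, h⟩ := exists_mem_forall_inner_ne
    (s := (fun p : Space n × ℝ => (p.1, (inner ℝ p.1 a : ℝ))) '' (halfSpaces Q ∩ {p | p.1 ≠ 0}))
    (((finite_halfSpaces hQ).inter_of_left _).image _)
    (by rintro _ ⟨p, hp, rfl⟩; exact hp.2) hO hne
  refine ⟨u, hu, fun p hp h0 => ?_⟩
  rw [inner_sub_right, sub_ne_zero]
  exact h _ ⟨p, ⟨hp, h0⟩, rfl⟩

theorem exists_isGeneric (hQ : Q.Finite) : ∃ u, IsGeneric Q u := by
  obtain ⟨u, -, hu⟩ := exists_isGeneric_sub hQ 0 isOpen_univ Set.univ_nonempty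
  exact ⟨u, by simpa using hu⟩

/-- One of the finitely many polyhedra contains `h + s • u` for arbitrarily small `s > 0`; being
closed and convex it contains `h`, and each of its half-spaces that is tight at `h` does not point
against `u`. -/
theorem interior_subset_sided [TopologicalSpace C] (hQ : Q.Finite) (u : Space n) :
    interior (sided Q 0) ⊆ sided Q u := by
  rintro ⟨v, c⟩ hv
  have hc : Continuous fun s : ℝ => (v + s • u, c) := by fun_prop
  have h1 : ∀ᶠ s : ℝ in 𝓝[>] 0, (v + s • u, c) ∈ sided Q 0 := by
    apply nhdsWithin_le_nhds
    refine hc.continuousAt.preimage_mem_nhds ?_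
    simpa using mem_interior_iff_mem_nhds.1 hv
  have h2 : ∃ q ∈ Q, ∃ᶠ s : ℝ in 𝓝[>] 0, c = q.2 ∧ ∀ p ∈ q.1, HalfSpaceCond p 0 (v + s • u) := by
    by_contra hcon
    simp only [not_exists, not_and, not_frequently] at hcon
    have := (eventually_all_finite hQ).2 fun q hq => hcon q hq
    obtain ⟨s, hs, q, hq, hs2⟩ := (this.and h1).exists
    exact hs q hq hs2.1 hs2.2
  obtain ⟨q, hq, hf⟩ := h2
  refine ⟨q, hq, hf.exists.choose_spec.1, fun p hp => ?_⟩
  have hle : ∃ᶠ s : ℝ in 𝓝[>] 0, inner ℝ p.1 v + s * inner ℝ p.1 u ≤ p.2 := by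
    refine hf.mono fun s hs => ?_
    have := hs.2 p hp
    simp only [HalfSpaceCond, inner_add_right, inner_smul_right] at this
    rcases this with h | h
    · exact h.le
    · exact h.1.le
  have hlim : Tendsto (fun s : ℝ => inner ℝ p.1 v + s * inner ℝ p.1 u) (𝓝[>] 0)
      (𝓝 (inner ℝ p.1 v)) := by
    have : Continuous (fun s : ℝ => inner ℝ p.1 v + s * inner ℝ p.1 u) := by fun_prop
    have := this.tendsto 0
    simp only [zero_mul, add_zero] at this
    exact this.mono_left nhdsWithin_le_nhds
  rcases lt_trichotomy (inner ℝ p.1 v) p.2 with h | h | h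
  · exact Or.inl h
  · refine Or.inr ⟨h, ?_⟩
    obtain ⟨s, hs, hs0⟩ := (hle.and_eventually self_mem_nhdsWithin).exists
    rw [h] at hs
    by_contra hcon
    push Not at hcon
    have := mul_pos (show 0 < s from hs0) hcon
    linarith
  · obtain ⟨s, hs, hs'⟩ := (hle.and_eventually (hlim.eventually_const_lt h)).exists
    exact absurd hs (not_le.2 hs')

/-- A small step in a generic direction leaves the bounding hyperplane. Off the hyperplane the
condition is locally constant and no longer depends on the direction `w`. -/
theorem eventually_halfSpaceCond_iff {p : Space n × ℝ} {u : Space n} (v : Space n)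
    (hu : p.1 ≠ 0 → inner ℝ p.1 u ≠ (0 : ℝ)) :
    ∀ᶠ s : ℝ in 𝓝[>] 0, ∀ᶠ k in 𝓝 (v + s • u), ∀ w,
      HalfSpaceCond p w k ↔ HalfSpaceCond p u v := by
  by_cases h0 : p.1 = 0
  · refine Eventually.of_forall fun s => Eventually.of_forall fun k w => ?_
    simp [HalfSpaceCond, h0]
  have hcont : Continuous fun k : Space n => (inner ℝ p.1 k : ℝ) := by fun_prop
  have hlt : ∀ a : Space n, inner ℝ p.1 a < p.2 →
      ∀ᶠ k in 𝓝 a, ∀ w, HalfSpaceCond p w k := fun a ha =>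
    ((hcont.tendsto a).eventually_lt_const ha).mono fun k hk w => Or.inl hk
  have hgt : ∀ a : Space n, p.2 < inner ℝ p.1 a →
      ∀ᶠ k in 𝓝 a, ∀ w, ¬ HalfSpaceCond p w k := fun a ha =>
    ((hcont.tendsto a).eventually_const_lt ha).mono fun k hk w => by
      rintro (h | h)
      · exact lt_asymm h hk
      · exact hk.ne' h.1
  have hlim : Tendsto (fun s : ℝ => inner ℝ p.1 (v + s • u)) (𝓝[>] 0) (𝓝 (inner ℝ p.1 v)) := by
    have : Continuous (fun s : ℝ => (inner ℝ p.1 (v + s • u) : ℝ)) := by fun_prop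
    have := this.tendsto 0
    simp only [zero_smul, add_zero] at this
    exact this.mono_left nhdsWithin_le_nhds
  rcases lt_trichotomy (inner ℝ p.1 v) p.2 with h | h | h
  · filter_upwards [hlim.eventually_lt_const h] with s hs
    filter_upwards [hlt _ hs] with k hk w
    exact iff_of_true (hk w) (Or.inl h)
  · rcases lt_or_gt_of_ne (hu h0) with h' | h'
    · filter_upwards [self_mem_nhdsWithin] with s hs
      filter_upwards [hlt (v + s • u) (by
        rw [inner_add_right, inner_smul_right, h]
        linarith [mul_neg_of_pos_of_neg (show 0 < s from hs) h'])] with k hk w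
      exact iff_of_true (hk w) (Or.inr ⟨h, h'.le⟩)
    · filter_upwards [self_mem_nhdsWithin] with s hs
      filter_upwards [hgt (v + s • u) (by
        rw [inner_add_right, inner_smul_right, h]
        linarith [mul_pos (show 0 < s from hs) h'])] with k hk w
      refine iff_of_false (hk w) ?_
      rintro (h1 | h1)
      · exact h1.ne h
      · exact absurd h1.2 (not_le.2 h')
  · filter_upwards [hlim.eventually_const_lt h] with s hs
    filter_upwards [hgt _ hs] with k hk w
    refine iff_of_false (hk w) ?_
    rintro (h1 | h1)
    · exact lt_asymm h1 h
    · exact h.ne' h1.1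

theorem eventually_mem_sided_iff (hQ : Q.Finite) {u : Space n} (hu : IsGeneric Q u)
    (h : Space n × C) :
    ∀ᶠ s : ℝ in 𝓝[>] 0, ∀ᶠ k in 𝓝 (h.1 + s • u), ∀ w,
      (k, h.2) ∈ sided Q w ↔ h ∈ sided Q u := by
  have h1 : ∀ᶠ s : ℝ in 𝓝[>] 0, ∀ p ∈ halfSpaces Q, ∀ᶠ k in 𝓝 (h.1 + s • u), ∀ w,
      HalfSpaceCond p w k ↔ HalfSpaceCond p u h.1 :=
    (eventually_all_finite (finite_halfSpaces hQ)).2 fun p hp =>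
      eventually_halfSpaceCond_iff h.1 (hu p hp)
  filter_upwards [h1] with s hs
  filter_upwards [(eventually_all_finite (finite_halfSpaces hQ)).2 hs] with k hk w
  exact sided_congr rfl fun p hp => hk p hp w

end Sided

/-! ### Patterns of a cut and project scheme -/

/-- The set of all `x` such that `(g, x)` is in the lattice for some `g ∈ V - h`. -/
def pattern {d : ℕ} {H : Type*} [AddCommGroup H] (Γ : AddSubgroup (H × Space d)) (V : Set H)
    (h : H) : Set (Space d) :=
  {x | ∃ g, (g, x) ∈ Γ ∧ h + g ∈ V}

theorem AgreeOn.mem_iff {d : ℕ} {R : ℝ} {A B : Set (Space d)} (h : AgreeOn R A B) {x : Space d}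
    (hx : ‖x‖ ≤ R) : x ∈ A ↔ x ∈ B := by
  have := Set.ext_iff.1 h x
  simpa [hx] using this

theorem agreeOn_iff {d : ℕ} {R : ℝ} {A B : Set (Space d)} :
    AgreeOn R A B ↔ ∀ x, ‖x‖ ≤ R → (x ∈ A ↔ x ∈ B) := by
  refine ⟨fun h x hx => h.mem_iff hx, fun h => ?_⟩
  ext x
  simp only [Set.mem_inter_iff, mem_closedBall_zero_iff]
  exact and_congr_left (h x)

theorem AgreeOn.symm {d : ℕ} {R : ℝ} {A B : Set (Space d)} (h : AgreeOn R A B) : AgreeOn R B A :=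
  Eq.symm h

theorem AgreeOn.trans {d : ℕ} {R : ℝ} {A B D : Set (Space d)} (h : AgreeOn R A B)
    (h' : AgreeOn R B D) : AgreeOn R A D :=
  Eq.trans h h'

theorem AgreeOn.mono {d : ℕ} {R R' : ℝ} {A B : Set (Space d)} (h : AgreeOn R A B) (hR : R' ≤ R) :
    AgreeOn R' A B :=
  agreeOn_iff.2 fun _ hx => h.mem_iff (hx.trans hR)

theorem mem_vadd_iff {d : ℕ} {A : Set (Space d)} {v x : Space d} : x ∈ v +ᵥ A ↔ x - v ∈ A := by
  rw [Set.mem_vadd_set_iff_neg_vadd_mem, vadd_eq_add, sub_eq_neg_add]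

section Pattern

variable {d : ℕ} {H : Type*} [AddCommGroup H] [TopologicalSpace H] (S : CutProjectScheme d H)

namespace CutProjectScheme

theorem eq_of_mem {g g' : H} {x : Space d} (h : (g, x) ∈ S.lattice) (h' : (g', x) ∈ S.lattice) :
    g = g' :=
  congrArg Prod.fst (S.injective h h' rfl)

theorem mem_pattern_iff {V : Set H} {h g : H} {x : Space d} (hg : (g, x) ∈ S.lattice) :
    x ∈ pattern S.lattice V h ↔ h + g ∈ V := by
  refine ⟨?_, fun h => ⟨g, hg, h⟩⟩
  rintro ⟨g', hg', h'⟩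
  rwa [S.eq_of_mem hg hg']

theorem zero_mem_pattern_iff {V : Set H} {h : H} : 0 ∈ pattern S.lattice V h ↔ h ∈ V := by
  rw [S.mem_pattern_iff (g := 0) S.lattice.zero_mem, add_zero]

theorem neg_vadd_pattern {V : Set H} {h g : H} {y : Space d} (hg : (g, y) ∈ S.lattice) :
    (-y) +ᵥ pattern S.lattice V h = pattern S.lattice V (h + g) := by
  ext x
  rw [mem_vadd_iff, sub_neg_eq_add]
  constructor
  · rintro ⟨g', hg', h'⟩
    refine ⟨g' - g, ?_, by simpa [add_assoc] using h'⟩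
    simpa using S.lattice.sub_mem hg' hg
  · rintro ⟨g', hg', h'⟩
    refine ⟨g' + g, S.lattice.add_mem hg' hg, ?_⟩
    rwa [add_comm g' g, ← add_assoc]

theorem projectionSet_mk (W : Set H) (k : H) (y : Space d) :
    S.projectionSet W ((k, y) : H × Space d) = y +ᵥ pattern S.lattice W k := by
  ext x
  rw [mem_vadd_iff]
  constructor
  · rintro ⟨h, hh, hx⟩
    rw [QuotientAddGroup.eq] at hx
    refine ⟨h - k, ?_, by simpa using hh⟩
    have := S.lattice.neg_mem hx
    rwa [neg_add_rev, neg_neg, ← sub_eq_neg_add, Prod.mk_sub_mk] at this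
  · rintro ⟨g, hg, h⟩
    refine ⟨k + g, h, ?_⟩
    rw [QuotientAddGroup.eq]
    have e : -(k + g, x) + (k, y) = -(g, x - y) :=
      Prod.ext (by simp) (by simp only [Prod.snd_add, Prod.snd_neg]; abel)
    rw [e]
    exact S.lattice.neg_mem hg

theorem isNonsingular_mk {W : Set H} {k : H} {y : Space d}
    (h : S.IsNonsingular W ((k, y) : H × Space d)) {g : H} {x : Space d}
    (hg : (g, x) ∈ S.lattice) : k + g ∉ frontier W := by
  refine h (k + g) (y + x) ?_
  rw [QuotientAddGroup.eq]
  simpa using S.lattice.neg_mem hg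

end CutProjectScheme

end Pattern

/-! ### Local finiteness, relative density and limits of patterns. -/

section Euclidean

set_option linter.unusedSectionVars false

variable {d n : ℕ} {C : Type*} [AddCommGroup C] [TopologicalSpace C] [DiscreteTopology C]
    [Finite C] (S : CutProjectScheme d (Space n × C))

namespace CutProjectScheme

theorem finite_lattice_inter (r K : ℝ) :
    {γ : (Space n × C) × Space d | γ ∈ S.lattice ∧ ‖γ.1.1‖ ≤ r ∧ ‖γ.2‖ ≤ K}.Finite := by
  have := S.discrete
  have hcl : IsClosed (S.lattice : Set ((Space n × C) × Space d)) :=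
    AddSubgroup.isClosed_of_discrete
  have hcomp : IsCompact ((Metric.closedBall (0 : Space n) r ×ˢ (Set.univ : Set C)) ×ˢ
      Metric.closedBall (0 : Space d) K) :=
    ((isCompact_closedBall 0 r).prod Set.finite_univ.isCompact).prod (isCompact_closedBall 0 K)
  have hdisc : IsDiscrete (S.lattice : Set ((Space n × C) × Space d)) := ⟨S.discrete⟩
  refine ((hcomp.inter_right hcl).finite (hdisc.mono Set.inter_subset_right)).subset ?_
  rintro γ ⟨h1, h2, h3⟩
  exact ⟨⟨⟨by simpa using h2, trivial⟩, by simpa using h3⟩, h1⟩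

theorem exists_lattice_mem_open (h : Space n × C) {O : Set (Space n)} (hO : IsOpen O)
    (hne : O.Nonempty) (c : C) :
    ∃ g x, (g, x) ∈ S.lattice ∧ (h + g).1 ∈ O ∧ (h + g).2 = c := by
  have hop : IsOpen {g : Space n × C | h + g ∈ O ×ˢ {c}} :=
    (hO.prod (isOpen_discrete {c})).preimage (by fun_prop)
  obtain ⟨_, ⟨γ, hγ, rfl⟩, hg⟩ := S.dense.exists_mem_open hop
    ⟨(hne.some, c) - h, by simpa using hne.some_mem⟩
  exact ⟨γ.1, γ.2, hγ, hg.1, hg.2⟩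

/-- The points of a pattern with window `V` form a relatively dense set, uniformly in the pattern,
when `V` has interior. -/
theorem exists_dist_pattern_le {V : Set (Space n × C)} (hV : IsOpen V) (hne : V.Nonempty) :
    ∃ ρ : ℝ, ∀ (h : Space n × C) (z : Space d), ∃ x ∈ pattern S.lattice V h, dist z x ≤ ρ := by
  have := S.cocompact
  let U : ℕ → Set (((Space n × C) × Space d) ⧸ S.lattice) := fun j =>
    (QuotientAddGroup.mk : _ → ((Space n × C) × Space d) ⧸ S.lattice) '' (V ×ˢ Metric.ball 0 j)
  have hUo : ∀ j, IsOpen (U j) := fun j =>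
    QuotientAddGroup.isOpenMap_coe _ (hV.prod Metric.isOpen_ball)
  have hcov : Set.univ ⊆ ⋃ j, U j := by
    rintro ξ -
    induction ξ using QuotientAddGroup.induction_on with
    | H z =>
      obtain ⟨h, x⟩ := z
      have hop : IsOpen {g : Space n × C | h + g ∈ V} := hV.preimage (by fun_prop)
      obtain ⟨_, ⟨γ, hγ, rfl⟩, hg⟩ := S.dense.exists_mem_open hop
        ⟨hne.some - h, by simpa using hne.some_mem⟩
      obtain ⟨j, hj⟩ := exists_nat_gt ‖x + γ.2‖
      refine Set.mem_iUnion.2 ⟨j, ⟨(h + γ.1, x + γ.2), ⟨hg, by simpa using hj⟩, ?_⟩⟩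
      rw [QuotientAddGroup.eq]
      have e : -(h + γ.1, x + γ.2) + (h, x) = -γ := Prod.ext (by simp) (by simp)
      rw [e]
      exact S.lattice.neg_mem hγ
  obtain ⟨t, ht⟩ := isCompact_univ.elim_finite_subcover U hUo hcov
  refine ⟨(t.sup id : ℕ), fun h z => ?_⟩
  have := ht (Set.mem_univ (((h, -z) : (Space n × C) × Space d) :
    ((Space n × C) × Space d) ⧸ S.lattice))
  simp only [Set.mem_iUnion] at this
  obtain ⟨j, hj, ⟨k, y⟩, ⟨hk, hy⟩, he⟩ := this
  rw [QuotientAddGroup.eq] at he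
  refine ⟨z + y, ⟨k - h, ?_, by simpa using hk⟩, ?_⟩
  · have := S.lattice.neg_mem he
    simpa [sub_eq_add_neg, add_comm] using this
  · rw [mem_ball_zero_iff] at hy
    simp only [dist_self_add_right]
    have : (j : ℝ) ≤ (t.sup id : ℕ) := by exact_mod_cast Finset.le_sup (f := id) hj
    linarith

/-- The points of the lattice with bounded internal coordinate. -/
def boundedPoints (r : ℝ) : Set (Space d) := {x | ∃ g, (g, x) ∈ S.lattice ∧ ‖g.1‖ ≤ r}

theorem finite_boundedPoints_inter (r K : ℝ) :
    (S.boundedPoints r ∩ Metric.closedBall 0 K).Finite := by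
  refine ((S.finite_lattice_inter r K).image Prod.snd).subset ?_
  rintro x ⟨⟨g, hg, hr⟩, hx⟩
  exact ⟨(g, x), ⟨hg, hr, by simpa using hx⟩, rfl⟩

theorem pattern_subset_boundedPoints {V : Set (Space n × C)} {r : ℝ} (hV : ∀ v ∈ V, ‖v.1‖ ≤ r)
    (h : Space n × C) : pattern S.lattice V h ⊆ S.boundedPoints (r + ‖h.1‖) := by
  rintro x ⟨g, hg, hgV⟩
  refine ⟨g, hg, ?_⟩
  have h1 := hV _ hgV
  have h2 : ‖g.1‖ ≤ ‖h.1 + g.1‖ + ‖h.1‖ := by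
    have := norm_sub_le (h.1 + g.1) h.1
    rwa [add_sub_cancel_left] at this
  rw [Prod.fst_add] at h1
  linarith

/-- All patterns in question are subsets of one locally finite set. In a bounded region its points
have a positive minimal distance, so closeness below that distance is equality. -/
theorem exists_agreeOn_of_close (r K : ℝ) :
    ∃ ε : ℝ, 0 < ε ∧ ∀ A B : Set (Space d), A ⊆ S.boundedPoints r → B ⊆ S.boundedPoints r →
      (A, B) ∈ localEntourage d K ε → AgreeOn K A B := by
  have hfin := S.finite_boundedPoints_inter r (K + 1)
  set D := S.boundedPoints r ∩ Metric.closedBall 0 (K + 1)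
  obtain ⟨ε, hε, hsep⟩ : ∃ ε : ℝ, 0 < ε ∧ ∀ a ∈ D, ∀ b ∈ D, dist a b ≤ ε → a = b := by
    have hf2 : ((D ×ˢ D) ∩ {q | q.1 ≠ q.2}).Finite := (hfin.prod hfin).inter_of_left _
    rcases Set.eq_empty_or_nonempty ((D ×ˢ D) ∩ {q | q.1 ≠ q.2}) with he | hne
    · refine ⟨1, one_pos, fun a ha b hb _ => ?_⟩
      by_contra hab
      have : (a, b) ∈ (D ×ˢ D) ∩ {q | q.1 ≠ q.2} := ⟨⟨ha, hb⟩, hab⟩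
      rw [he] at this
      exact this
    · obtain ⟨q, hq, hmin⟩ := Set.exists_min_image _ (fun q => dist q.1 q.2) hf2 hne
      have hpos : 0 < dist q.1 q.2 := dist_pos.2 hq.2
      refine ⟨dist q.1 q.2 / 2, by positivity, fun a ha b hb hab => ?_⟩
      by_contra hne
      have := hmin (a, b) ⟨⟨ha, hb⟩, hne⟩
      simp only at this
      linarith
  have hmemD : ∀ a b : Space d, a ∈ S.boundedPoints r → ‖b‖ ≤ K → dist b a ≤ min ε 1 → a ∈ D := by
    intro a b ha hb hab
    refine ⟨ha, ?_⟩
    rw [mem_closedBall_zero_iff]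
    have := norm_le_norm_add_norm_sub' a b
    rw [← dist_eq_norm, dist_comm] at this
    linarith [min_le_right ε 1]
  refine ⟨min ε 1, by positivity, fun A B hA hB h => agreeOn_iff.2 fun x hx => ?_⟩
  constructor
  · intro hxA
    obtain ⟨b, hb, hxb⟩ := h.1 x hxA hx
    rwa [hsep x (hmemD x x (hA hxA) hx (by simp [hε.le])) b (hmemD b x (hB hb) hx hxb)
      (hxb.trans (min_le_left _ _))]
  · intro hxB
    obtain ⟨b, hb, hxb⟩ := h.2 x hxB hx
    rwa [hsep x (hmemD x x (hB hxB) hx (by simp [hε.le])) b (hmemD b x (hA hb) hx hxb)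
      (hxb.trans (min_le_left _ _))]

variable {Q : Set (Finset (Space n × ℝ) × C)}

theorem eventually_agreeOn_pattern (hQ : Q.Finite) {r : ℝ} (hr : ∀ v ∈ sided Q 0, ‖v.1‖ ≤ r)
    {u : Space n} (hu : IsGeneric Q u) (h : Space n × C) (K : ℝ) :
    ∀ᶠ s : ℝ in 𝓝[>] 0, ∀ᶠ k in 𝓝 (h.1 + s • u), ∀ w,
      AgreeOn K (pattern S.lattice (sided Q w) (k, h.2)) (pattern S.lattice (sided Q u) h) := by
  -- The `+ 1` leaves room for the parameter to vary near `h`; the finitely many lattice points of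
  -- this set decide all patterns involved on the ball of radius `K`.
  have hfin := S.finite_lattice_inter (r + (‖h.1‖ + 1)) K
  have h1 := (eventually_all_finite hfin).2 fun γ _ => eventually_mem_sided_iff hQ hu (h + γ.1)
  have h2 : ∀ᶠ s : ℝ in 𝓝[>] 0, ‖h.1 + s • u‖ < ‖h.1‖ + 1 := by
    have hc : Continuous fun s : ℝ => ‖h.1 + s • u‖ := by fun_prop
    have := hc.tendsto 0
    simp only [zero_smul, add_zero] at this
    exact (this.mono_left nhdsWithin_le_nhds).eventually_lt_const (by linarith)
  filter_upwards [h1, h2] with s hs hs2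
  have h3 : ∀ᶠ k in 𝓝 (h.1 + s • u), ∀ γ ∈ {γ : (Space n × C) × Space d |
      γ ∈ S.lattice ∧ ‖γ.1.1‖ ≤ r + (‖h.1‖ + 1) ∧ ‖γ.2‖ ≤ K}, ∀ w,
      (k + γ.1.1, h.2 + γ.1.2) ∈ sided Q w ↔ h + γ.1 ∈ sided Q u := by
    refine (eventually_all_finite hfin).2 fun γ hγ => ?_
    have hc : Tendsto (fun k : Space n => k + γ.1.1) (𝓝 (h.1 + s • u))
        (𝓝 ((h + γ.1).1 + s • u)) := by
      have : Continuous fun k : Space n => k + γ.1.1 := by fun_prop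
      have := this.tendsto (h.1 + s • u)
      rwa [add_right_comm] at this
    exact hc.eventually (hs γ hγ)
  have h4 : ∀ᶠ k in 𝓝 (h.1 + s • u), ‖k‖ < ‖h.1‖ + 1 :=
    (continuous_norm.tendsto _).eventually_lt_const hs2
  filter_upwards [h3, h4] with k hk hk2 w
  refine agreeOn_iff.2 fun x hx => ?_
  constructor
  · rintro ⟨g, hg, hgV⟩
    refine ⟨g, hg, (hk (g, x) ⟨hg, ?_, hx⟩ w).1 hgV⟩
    have := S.pattern_subset_boundedPoints (V := sided Q w) (fun v hv => hr v (sided_subset w hv))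
      (k, h.2) ⟨g, hg, hgV⟩
    obtain ⟨g', hg', hr'⟩ := this
    rw [S.eq_of_mem hg hg']
    exact hr'.trans (by simpa using hk2.le)
  · rintro ⟨g, hg, hgV⟩
    refine ⟨g, hg, (hk (g, x) ⟨hg, ?_, hx⟩ w).2 hgV⟩
    have := S.pattern_subset_boundedPoints (V := sided Q u) (fun v hv => hr v (sided_subset u hv))
      h ⟨g, hg, hgV⟩
    obtain ⟨g', hg', hr'⟩ := this
    rw [S.eq_of_mem hg hg']
    exact hr'.trans (by linarith)

/-- A pattern seen from a generic direction agrees, on a given ball, with all patterns whose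
parameter lies in some open set arbitrarily close to the given parameter. -/
theorem exists_isOpen_agreeOn_pattern (hQ : Q.Finite) {r : ℝ} (hr : ∀ v ∈ sided Q 0, ‖v.1‖ ≤ r)
    {u : Space n} (hu : IsGeneric Q u) (h : Space n × C) (K : ℝ) {ε : ℝ} (hε : 0 < ε) :
    ∃ O : Set (Space n), IsOpen O ∧ O.Nonempty ∧ O ⊆ Metric.ball h.1 ε ∧ ∀ k ∈ O, ∀ w,
      AgreeOn K (pattern S.lattice (sided Q w) (k, h.2)) (pattern S.lattice (sided Q u) h) := by
  have h1 := S.eventually_agreeOn_pattern hQ hr hu h K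
  have h2 : ∀ᶠ s : ℝ in 𝓝[>] 0, h.1 + s • u ∈ Metric.ball h.1 ε := by
    apply nhdsWithin_le_nhds
    have hc : Continuous fun s : ℝ => h.1 + s • u := by fun_prop
    exact hc.continuousAt.preimage_mem_nhds (by simpa using Metric.ball_mem_nhds h.1 hε)
  obtain ⟨s, hs, hs2⟩ := (h1.and h2).exists
  obtain ⟨O, hO, hOo, hm⟩ := eventually_nhds_iff.1
    (hs.and (Metric.isOpen_ball.eventually_mem hs2))
  exact ⟨O, hOo, ⟨_, hm⟩, fun k hk => (hO k hk).2, fun k hk => (hO k hk).1⟩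

/-- A set that is approximated by patterns with generic direction is itself such a pattern. -/
theorem exists_eq_pattern (hQ : Q.Finite) (hW : IsCompact (sided Q 0)) {A : Set (Space d)}
    (h0 : 0 ∈ A) (hA : ∀ K : ℝ, ∃ k w, IsGeneric Q w ∧
      AgreeOn K A (pattern S.lattice (sided Q w) k)) :
    ∃ h u, IsGeneric Q u ∧ A = pattern S.lattice (sided Q u) h := by
  obtain ⟨r, hr⟩ : ∃ r, ∀ v ∈ sided Q 0, ‖v.1‖ ≤ r :=
    hW.exists_bound_of_continuousOn continuous_fst.continuousOn
  choose k w hw hag using fun j : ℕ => hA j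
  have hkW : ∀ j, k j ∈ sided Q 0 := fun j =>
    sided_subset (w j) (S.zero_mem_pattern_iff.1 (((hag j).mem_iff (by simp)).1 h0))
  obtain ⟨h, -, φ, hφ, hlim⟩ := hW.tendsto_subseq hkW
  -- The parameter is moved slightly off `k (φ j)` without changing the pattern on the ball of
  -- radius `j`, so that it approaches the limit `h` from a generic direction.
  have hstep : ∀ j : ℕ, ∃ k' : Space n, dist k' (k (φ j)).1 < 1 / ((j : ℝ) + 1) ∧
      IsGeneric Q (k' - h.1) ∧
      AgreeOn j A (pattern S.lattice (sided Q 0) (k', (k (φ j)).2)) := by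
    intro j
    obtain ⟨O, hO, hne, hball, hOag⟩ := S.exists_isOpen_agreeOn_pattern hQ hr (hw (φ j)) (k (φ j))
      j (ε := 1 / ((j : ℝ) + 1)) (by positivity)
    obtain ⟨k', hk', hgen⟩ := exists_isGeneric_sub hQ h.1 hO hne
    refine ⟨k', hball hk', hgen, ?_⟩
    have : (j : ℝ) ≤ φ j := by exact_mod_cast hφ.id_le j
    exact ((hag (φ j)).mono this).trans (hOag k' hk' 0).symm
  choose k' hdist hgen hag' using hstep
  have hk1 : Tendsto (fun j => (k (φ j)).1) atTop (𝓝 h.1) :=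
    (continuous_fst.tendsto h).comp hlim
  have hk2 : ∀ᶠ j in atTop, (k (φ j)).2 = h.2 := by
    have := (continuous_snd.tendsto h).comp hlim
    rw [nhds_discrete] at this
    exact tendsto_pure.1 this
  have hk' : Tendsto k' atTop (𝓝 h.1) := by
    have hd : Tendsto (fun j : ℕ => dist (k' j) (k (φ j)).1) atTop (𝓝 0) :=
      squeeze_zero (fun _ => dist_nonneg) (fun j => (hdist j).le)
        tendsto_one_div_add_atTop_nhds_zero_nat
    exact (tendsto_iff_of_dist (by simpa [dist_comm] using hd)).1 hk1
  have := (finite_halfSpaces hQ).to_subtype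
  -- There are finitely many sign patterns of `k' j - h.1` relative to the half-spaces, so
  -- infinitely many `j` share one. Any of these approach directions serves as the direction of the
  -- limit pattern.
  obtain ⟨σ, hσ⟩ := Finite.exists_infinite_fiber
    (fun (j : ℕ) (p : halfSpaces Q) => inner ℝ p.1.1 (k' j - h.1) ≤ (0 : ℝ))
  rw [Set.infinite_coe_iff] at hσ
  obtain ⟨j₀, hj₀⟩ := hσ.nonempty
  refine ⟨h, k' j₀ - h.1, hgen j₀, ?_⟩
  ext x
  by_cases hx : ∃ g, (g, x) ∈ S.lattice
  · obtain ⟨g, hg⟩ := hx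
    have hev : ∀ p ∈ halfSpaces Q, ∀ᶠ j in atTop,
        (inner ℝ p.1 (k' j - h.1) ≤ (0 : ℝ) ↔ inner ℝ p.1 (k' j₀ - h.1) ≤ (0 : ℝ)) →
        (HalfSpaceCond p 0 (k' j + g.1) ↔ HalfSpaceCond p (k' j₀ - h.1) (h.1 + g.1)) := by
      intro p hp
      have hlim2 : Tendsto (fun j => (inner ℝ p.1 (k' j + g.1) : ℝ)) atTop
          (𝓝 (inner ℝ p.1 (h.1 + g.1))) := by
        have hc : Continuous fun y : Space n => (inner ℝ p.1 (y + g.1) : ℝ) := by fun_prop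
        exact (hc.tendsto h.1).comp hk'
      rcases lt_trichotomy (inner ℝ p.1 (h.1 + g.1)) p.2 with hlt | heq | hgt
      · filter_upwards [hlim2.eventually_lt_const hlt] with j hj _
        exact iff_of_true (Or.inl hj) (Or.inl hlt)
      -- When the limit point is on the hyperplane, the sign of `k' j - h.1` decides on which side
      -- the approximating point lies.
      · refine Eventually.of_forall fun j hj => ?_
        have e1 : (inner ℝ p.1 (k' j + g.1) : ℝ) = p.2 + inner ℝ p.1 (k' j - h.1) := by
          rw [← heq, ← inner_add_right]
          congr 1
          abel
        simp only [HalfSpaceCond, inner_zero_right, le_refl, and_true, ← le_iff_lt_or_eq, heq,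
          lt_self_iff_false, false_or, true_and, e1]
        rw [← hj]
        constructor <;> intro h <;> linarith
      · filter_upwards [hlim2.eventually_const_lt hgt] with j hj _
        refine iff_of_false ?_ ?_
        · rintro (h | h)
          · exact lt_asymm h hj
          · exact hj.ne' h.1
        · rintro (h | h)
          · exact lt_asymm h hgt
          · exact hgt.ne' h.1
    have hev2 := (eventually_all_finite (finite_halfSpaces hQ)).2 hev
    obtain ⟨N, hN⟩ := exists_nat_ge ‖x‖
    have hev3 := (hev2.and hk2).and (eventually_ge_atTop N)
    obtain ⟨j, ⟨⟨hj1, hj2⟩, hj3⟩, hj4⟩ := (hev3.and_frequently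
      (Nat.frequently_atTop_iff_infinite.2 hσ)).exists
    have hxj : ‖x‖ ≤ j := hN.trans (by exact_mod_cast hj3)
    rw [(hag' j).mem_iff hxj, S.mem_pattern_iff hg, S.mem_pattern_iff hg]
    refine sided_congr (by simp [hj2]) fun p hp => hj1 p hp ?_
    have e1 := congrFun (show _ = σ from hj4) ⟨p, hp⟩
    have e2 := congrFun (show _ = σ from hj₀) ⟨p, hp⟩
    exact iff_of_eq (e1.trans e2.symm)
  · refine iff_of_false (fun hxA => ?_) (fun ⟨g, hg, _⟩ => hx ⟨g, hg⟩)
    obtain ⟨N, hN⟩ := exists_nat_ge ‖x‖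
    obtain ⟨g, hg, _⟩ := ((hag N).mem_iff hN).1 hxA
    exact hx ⟨g, hg⟩

/-- Every pattern with generic direction is approximated by translates of any other one. -/
theorem exists_agreeOn_pattern_add (hQ : Q.Finite) {r : ℝ} (hr : ∀ v ∈ sided Q 0, ‖v.1‖ ≤ r)
    {u : Space n} (hu : IsGeneric Q u) (h h₀ : Space n × C) (K : ℝ) :
    ∃ g x, (g, x) ∈ S.lattice ∧ ∀ w,
      AgreeOn K (pattern S.lattice (sided Q w) (h₀ + g)) (pattern S.lattice (sided Q u) h) := by
  obtain ⟨O, hO, hne, -, hag⟩ := S.exists_isOpen_agreeOn_pattern hQ hr hu h K one_pos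
  obtain ⟨g, x, hg, h1, h2⟩ := S.exists_lattice_mem_open h₀ hO hne h.2
  refine ⟨g, x, hg, fun w => ?_⟩
  have : h₀ + g = ((h₀ + g).1, h.2) := by rw [← h2]
  rw [this]
  exact hag _ h1 w

end CutProjectScheme

end Euclidean

/-! ### Lattice points over a hyperplane of the internal space. -/

section Slab

set_option linter.unusedSectionVars false

variable {d n : ℕ} {C : Type*} [AddCommGroup C] [TopologicalSpace C] [DiscreteTopology C]
    [Finite C] (S : CutProjectScheme d (Space n × C))

/-- The real span of a subgroup is contained in a bounded neighbourhood of the subgroup. -/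
theorem AddSubgroup.exists_norm_sub_le {E : Type*} [NormedAddCommGroup E] [NormedSpace ℝ E]
    [FiniteDimensional ℝ E] (L : AddSubgroup E) :
    ∃ κ : ℝ, ∀ e ∈ Submodule.span ℝ (L : Set E), ∃ γ ∈ L, ‖e - γ‖ ≤ κ := by
  obtain ⟨b, hbL, hspan, hli⟩ := exists_linearIndependent ℝ (L : Set E)
  have hb : b.Finite := hli.setFinite
  refine ⟨∑ a ∈ hb.toFinset, ‖a‖, fun e he => ?_⟩
  rw [← hspan, ← hb.coe_toFinset, Submodule.mem_span_finset] at he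
  obtain ⟨f, -, rfl⟩ := he
  refine ⟨∑ a ∈ hb.toFinset, ⌊f a⌋ • a, L.sum_mem fun a ha =>
    L.zsmul_mem (hbL (hb.mem_toFinset.1 ha)) _, ?_⟩
  rw [← Finset.sum_sub_distrib]
  refine (norm_sum_le _ _).trans (Finset.sum_le_sum fun a _ => ?_)
  rw [← Int.cast_smul_eq_zsmul ℝ, ← sub_smul, norm_smul]
  refine mul_le_of_le_one_left (norm_nonneg _) ?_
  change ‖Int.fract (f a)‖ ≤ 1
  rw [Real.norm_of_nonneg (Int.fract_nonneg _)]
  exact (Int.fract_lt_one _).le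

namespace CutProjectScheme

/-- The lattice points whose internal coordinate is orthogonal to `v`. -/
def orthogonalSublattice (v : Space n) : AddSubgroup (Space n × Space d) where
  carrier := {e | ∃ c, ((e.1, c), e.2) ∈ S.lattice ∧ inner ℝ v e.1 = (0 : ℝ)}
  zero_mem' := ⟨0, S.lattice.zero_mem, by simp⟩
  add_mem' := by
    rintro a b ⟨c, h, h'⟩ ⟨c', k, k'⟩
    exact ⟨c + c', S.lattice.add_mem h k, by simp [inner_add_right, h', k']⟩
  neg_mem' := by
    rintro a ⟨c, h, h'⟩
    exact ⟨-c, S.lattice.neg_mem h, by simp [h']⟩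

/-- If the span contained the whole physical space, every lattice point over the unit ball could be
brought into a bounded region by subtracting a sublattice point, without changing `⟪v, ·⟫`. That
leaves finitely many values of `⟪v, ·⟫`, whereas the lattice projects densely. -/
theorem exists_notMem_span_orthogonalSublattice {v : Space n} (hv : v ≠ 0) :
    ∃ x : Space d, ((0 : Space n), x) ∉
      Submodule.span ℝ (S.orthogonalSublattice v : Set (Space n × Space d)) := by
  by_contra! hcon
  obtain ⟨κ, hκ⟩ := (S.orthogonalSublattice v).exists_norm_sub_le
  have hfin := (S.finite_lattice_inter (1 + κ) κ).image
    fun γ => (inner ℝ v γ.1.1 : ℝ)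
  set V := (fun γ : (Space n × C) × Space d => (inner ℝ v γ.1.1 : ℝ)) ''
    {γ : (Space n × C) × Space d | γ ∈ S.lattice ∧ ‖γ.1.1‖ ≤ 1 + κ ∧ ‖γ.2‖ ≤ κ} with hV
  have hc : Continuous fun y : Space n => (inner ℝ v y : ℝ) := by fun_prop
  have hO : IsOpen (Metric.ball (0 : Space n) 1 ∩ {y | inner ℝ v y ∉ V}) :=
    Metric.isOpen_ball.inter (hfin.isClosed.isOpen_compl.preimage hc)
  obtain ⟨y, hy, hyV⟩ := exists_mem_forall_inner_ne (s := (fun b => (v, b)) '' V) (hfin.image _)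
    (by rintro _ ⟨b, -, rfl⟩; exact hv) (O := Metric.ball (0 : Space n) 1) Metric.isOpen_ball
    ⟨0, by simp⟩
  obtain ⟨g, x, hg, ⟨hg1, hg2⟩, -⟩ := S.exists_lattice_mem_open 0 hO
    ⟨y, hy, fun h => hyV _ ⟨_, h, rfl⟩ rfl⟩ 0
  rw [zero_add] at hg1 hg2
  rw [mem_ball_zero_iff] at hg1
  obtain ⟨γ, ⟨c, hγ, hγv⟩, hdist⟩ := hκ _ (hcon x)
  have h1 : ‖γ.1‖ ≤ κ := by
    have := (norm_fst_le _).trans hdist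
    simpa using this
  have h2 : ‖x - γ.2‖ ≤ κ := (norm_snd_le ((0, x) - γ)).trans hdist
  refine hg2 ⟨(g, x) - ((γ.1, c), γ.2), ⟨S.lattice.sub_mem hg hγ, ?_, h2⟩, ?_⟩
  · exact (norm_sub_le _ _).trans (by linarith)
  · simp [inner_sub_right, hγv]

/-- The lattice points whose internal coordinate is bounded and has one of finitely many values
in a given direction, have physical coordinate in a slab. -/
theorem exists_slab {v : Space n} (hv : v ≠ 0) {B : Set ℝ} (hB : B.Finite) (r : ℝ) :
    ∃ w : Space d, w ≠ 0 ∧ ∃ K : ℝ, ∀ g x, (g, x) ∈ S.lattice → ‖g.1‖ ≤ r →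
      (inner ℝ v g.1 : ℝ) ∈ B → |inner ℝ w x| ≤ K := by
  obtain ⟨x₀, hx₀⟩ := S.exists_notMem_span_orthogonalSublattice hv
  -- `f` vanishes on the sublattice but not on the physical space. So its physical part `⟪w, ·⟫` is
  -- nonzero, and on the sublattice it is minus the internal part, which is bounded for bounded
  -- internal coordinate.
  obtain ⟨f, hf0, hf⟩ := Submodule.exists_le_ker_of_notMem hx₀
  set w : Space d := (InnerProductSpace.toDual ℝ (Space d)).symm
    (LinearMap.toContinuousLinearMap (f.comp (LinearMap.inr ℝ (Space n) (Space d)))) with hw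
  have hwx : ∀ x, inner ℝ w x = f (0, x) := fun x => by
    rw [hw, InnerProductSpace.toDual_symm_apply]
    rfl
  set φ := LinearMap.toContinuousLinearMap (f.comp (LinearMap.inl ℝ (Space n) (Space d)))
  have hbase : ∀ g x, (g, x) ∈ S.lattice → inner ℝ v g.1 = (0 : ℝ) →
      |inner ℝ w x| ≤ ‖φ‖ * ‖g.1‖ := by
    intro g x hg hgv
    have h1 : f (g.1, x) = 0 := hf (Submodule.subset_span ⟨g.2, hg, hgv⟩)
    have h2 : f (g.1, x) = f (g.1, 0) + f (0, x) := by rw [← map_add]; simp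
    rw [hwx, show f (0, x) = -φ g.1 by change _ = -f (g.1, 0); linarith, abs_neg]
    exact φ.le_opNorm g.1
  have hb : ∀ b : ℝ, ∃ K : ℝ, ∀ g x, (g, x) ∈ S.lattice → ‖g.1‖ ≤ r →
      (inner ℝ v g.1 : ℝ) = b → |inner ℝ w x| ≤ K := by
    intro b
    by_cases h : ∃ g x, (g, x) ∈ S.lattice ∧ ‖g.1‖ ≤ r ∧ (inner ℝ v g.1 : ℝ) = b
    · obtain ⟨g₀, x₀, h1, h2, h3⟩ := h
      -- Subtracting one fixed lattice point with value `b` reduces to the value `0`.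
      refine ⟨‖φ‖ * (r + r) + |inner ℝ w x₀|, fun g x h1' h2' h3' => ?_⟩
      have h4 := hbase (g - g₀) (x - x₀) (S.lattice.sub_mem h1' h1)
        (by rw [Prod.fst_sub, inner_sub_right, h3, h3', sub_self])
      have h5 : ‖φ‖ * ‖(g - g₀).1‖ ≤ ‖φ‖ * (r + r) :=
        mul_le_mul_of_nonneg_left ((norm_sub_le _ _).trans (add_le_add h2' h2)) (norm_nonneg _)
      rw [inner_sub_right] at h4
      have h6 := abs_sub_abs_le_abs_sub (inner ℝ w x) (inner ℝ w x₀)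
      linarith
    · refine ⟨0, fun g x h1 h2 h3 => absurd ⟨g, x, h1, h2, h3⟩ h⟩
  choose κ hκ using hb
  obtain ⟨K, hK⟩ := (hB.image κ).bddAbove
  refine ⟨w, ?_, K, fun g x h1 h2 h3 => (hκ _ g x h1 h2 rfl).trans (hK ⟨_, h3, rfl⟩)⟩
  intro h0
  apply hf0
  rw [← hwx, h0, inner_zero_left]

end CutProjectScheme

end Slab

/-! ### The torus parametrization -/

theorem localEntourage_mem_uniformity {d : ℕ} (R : ℝ) {ε : ℝ} (hε : 0 < ε) :
    localEntourage d R ε ∈ 𝓤 (Set (Space d)) :=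
  (localBasis d).mem_filter_of_mem ⟨R, ε, hε, rfl⟩

theorem exists_localEntourage_subset {d : ℕ} {V : Set (Set (Space d) × Set (Space d))}
    (hV : V ∈ 𝓤 (Set (Space d))) : ∃ R ε : ℝ, 0 < ε ∧ localEntourage d R ε ⊆ V := by
  obtain ⟨_, ⟨R, ε, hε, rfl⟩, h⟩ := (localBasis d).mem_filter_iff.1 hV
  exact ⟨R, ε, hε, h⟩

theorem exists_mem_localEntourage_of_mem_closure {d : ℕ} {𝒜 : Set (Set (Space d))}
    {A : Set (Space d)} (hA : A ∈ closure 𝒜) (R : ℝ) {ε : ℝ} (hε : 0 < ε) :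
    ∃ B ∈ 𝒜, (A, B) ∈ localEntourage d R ε := by
  obtain ⟨B, hB, h⟩ := mem_closure_iff_nhds.1 hA _
    (UniformSpace.ball_mem_nhds A (localEntourage_mem_uniformity R hε))
  exact ⟨B, h, hB⟩

section Torus

set_option linter.unusedSectionVars false

variable {d n : ℕ} {C : Type*} [AddCommGroup C] [TopologicalSpace C] [DiscreteTopology C]
    [Finite C] (S : CutProjectScheme d (Space n × C))

/-- By closure `W + a ⊆ W`, and this can be iterated. Boundedness of `W` forces `a.1 = 0`, so `a`
has finite order; then `W + a = W` and aperiodicity applies. -/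
theorem IsWindow.eq_zero_of_forall_add_mem {W : Set (Space n × C)} (hW : IsWindow W)
    {a : Space n × C} (ha : ∀ h ∈ interior W, h + a ∈ W) : a = 0 := by
  have h1 : ∀ h ∈ W, h + a ∈ W := by
    intro h hh
    rw [← hW.closure_interior] at hh
    have hcl : IsClosed {h : Space n × C | h + a ∈ W} :=
      hW.isCompact.isClosed.preimage (by fun_prop)
    exact closure_minimal ha hcl hh
  have h2 : ∀ (k : ℕ), ∀ h ∈ W, h + k • a ∈ W := by
    intro k
    induction k with
    | zero => simp
    | succ k ih =>
      intro h hh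
      rw [succ_nsmul, ← add_assoc]
      exact h1 _ (ih h hh)
  obtain ⟨r, hr⟩ : ∃ r, ∀ v ∈ W, ‖v.1‖ ≤ r :=
    hW.isCompact.exists_bound_of_continuousOn continuous_fst.continuousOn
  obtain ⟨h₀, hh₀⟩ := hW.nonempty
  have ha1 : a.1 = 0 := by
    by_contra hne
    have hpos : 0 < ‖a.1‖ := norm_pos_iff.2 hne
    obtain ⟨k, hk⟩ := exists_nat_gt ((r + ‖h₀.1‖) / ‖a.1‖)
    rw [div_lt_iff₀ hpos] at hk
    have h3 := hr _ (h2 k h₀ hh₀)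
    have h4 := norm_sub_le (h₀ + k • a).1 h₀.1
    have h5 : (h₀ + k • a).1 - h₀.1 = k • a.1 := by simp
    rw [h5, ← Nat.cast_smul_eq_nsmul ℝ, norm_smul, Real.norm_natCast] at h4
    linarith
  have hm := addOrderOf_pos a.2
  have hma : addOrderOf a.2 • a = 0 :=
    Prod.ext (by simp [ha1]) (by simp)
  refine hW.aperiodic a (Set.Subset.antisymm ?_ ?_)
  · rintro _ ⟨h, hh, rfl⟩
    simpa [add_comm] using h1 h hh
  · intro h hh
    refine ⟨h + (addOrderOf a.2 - 1) • a, h2 _ h hh, ?_⟩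
    have : a + (addOrderOf a.2 - 1) • a = 0 := by
      rw [← hma]
      conv_rhs => rw [← Nat.sub_add_cancel hm, succ_nsmul, add_comm]
    simp only [vadd_eq_add]
    rw [add_left_comm, this, add_zero]

namespace CutProjectScheme

/-- The torus `(H × ℝ^d) / Γ`. -/
abbrev Torus : Type _ := ((Space n × C) × Space d) ⧸ S.lattice

/-- The pairs of a pattern `A` and a parameter `ξ` such that `A` lies, up to closure, between the
projection sets with parameter `ξ` of the interior of the window and of the window. -/
def torusGraph (W : Set (Space n × C)) : Set (Set (Space d) × S.Torus) :=
  {p | (∀ x ∈ p.1, ∃ h ∈ W, ((h, x) : (Space n × C) × Space d) = p.2) ∧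
    ∀ h ∈ interior W, ∀ x : Space d, ((h, x) : (Space n × C) × Space d) = p.2 → x ∈ closure p.1}

theorem t2Space_torus : T2Space S.Torus := by
  have := S.discrete
  have hcl : IsClosed (S.lattice : Set ((Space n × C) × Space d)) :=
    AddSubgroup.isClosed_of_discrete
  infer_instance

theorem isClosed_setOf_exists_mem {W : Set (Space n × C)} (hW : IsCompact W) :
    IsClosed {p : S.Torus × Space d | ∃ h ∈ W, ((h, p.2) : (Space n × C) × Space d) = p.1} := by
  have := S.t2Space_torus
  have hE : IsClosed ((fun h : Space n × C =>
      (((h, (0 : Space d)) : (Space n × C) × Space d) : S.Torus)) '' W) :=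
    (hW.image (QuotientAddGroup.continuous_mk.comp (by fun_prop))).isClosed
  have hc : Continuous fun p : S.Torus × Space d =>
      p.1 - (((0, p.2) : (Space n × C) × Space d) : S.Torus) :=
    continuous_fst.sub (QuotientAddGroup.continuous_mk.comp (by fun_prop))
  convert hE.preimage hc using 1
  ext ⟨ξ, x⟩
  refine exists_congr fun h => and_congr_right fun _ => ?_
  rw [eq_sub_iff_add_eq, ← QuotientAddGroup.mk_add]
  simp

/-- Closedness yields both the existence of torus parameters on the hull and their continuity, by
compactness of the torus. The closure in the second defining condition lets it pass to limits
without an appeal to local finiteness. -/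
theorem isClosed_torusGraph {W : Set (Space n × C)} (hW : IsCompact W) :
    IsClosed (S.torusGraph W) := by
  refine isClosed_of_closure_subset ?_
  rintro ⟨A, ξ⟩ hA
  rw [mem_closure_iff_nhds] at hA
  have happ : ∀ (R : ℝ) {ε : ℝ} (_ : 0 < ε) {U : Set S.Torus} (_ : U ∈ 𝓝 ξ),
      ∃ B ζ, (A, B) ∈ localEntourage d R ε ∧ ζ ∈ U ∧ (B, ζ) ∈ S.torusGraph W := by
    intro R ε hε U hU
    obtain ⟨⟨B, ζ⟩, ⟨h1, h2⟩, h3⟩ := hA _ (prod_mem_nhds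
      (UniformSpace.ball_mem_nhds A (localEntourage_mem_uniformity R hε)) hU)
    exact ⟨B, ζ, h1, h2, h3⟩
  constructor
  · intro x hx
    by_contra hcon
    have hop := (S.isClosed_setOf_exists_mem hW).isOpen_compl.mem_nhds
      (show (ξ, x) ∈ {p : S.Torus × Space d |
        ∃ h ∈ W, ((h, p.2) : (Space n × C) × Space d) = p.1}ᶜ from hcon)
    obtain ⟨U, hU, V, hV, hUV⟩ := mem_nhds_prod_iff.1 hop
    obtain ⟨ε, hε, hball⟩ := Metric.mem_nhds_iff.1 hV
    obtain ⟨B, ζ, h1, h2, h3⟩ := happ ‖x‖ (half_pos hε) hU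
    obtain ⟨b, hb, hxb⟩ := h1.1 x hx le_rfl
    refine hUV (show (ζ, b) ∈ U ×ˢ V from ⟨h2, hball ?_⟩) (h3.1 b hb)
    rw [Metric.mem_ball, dist_comm]
    linarith
  · intro h hh x hx
    rw [Metric.mem_closure_iff]
    intro ε hε
    have hU : (QuotientAddGroup.mk '' (interior W ×ˢ Metric.ball x (ε / 4)) : Set S.Torus) ∈ 𝓝 ξ := by
      refine (QuotientAddGroup.isOpenMap_coe _
        (isOpen_interior.prod Metric.isOpen_ball)).mem_nhds ?_
      exact ⟨(h, x), ⟨hh, Metric.mem_ball_self (by positivity)⟩, hx⟩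
    obtain ⟨B, ζ, h1, ⟨⟨h', x'⟩, ⟨hh', hx'⟩, rfl⟩, h3⟩ :=
      happ (‖x‖ + ε) (show 0 < ε / 4 by positivity) hU
    obtain ⟨b, hb, hxb⟩ := Metric.mem_closure_iff.1 (h3.2 h' hh' x' rfl) (ε / 4) (by positivity)
    rw [Metric.mem_ball, dist_comm] at hx'
    have hxb' : dist x b < ε / 2 := by linarith [dist_triangle x x' b]
    obtain ⟨a, ha, hba⟩ := h1.2 b hb (by
      have := norm_le_norm_add_norm_sub' b x
      rw [← dist_eq_norm, dist_comm] at this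
      linarith)
    exact ⟨a, ha, by linarith [dist_triangle x b a]⟩

theorem exists_mk_eq {V : Set (Space n × C)} (hV : IsOpen V) (hne : V.Nonempty) (ξ : S.Torus) :
    ∃ h ∈ V, ∃ x : Space d, ((h, x) : (Space n × C) × Space d) = ξ := by
  obtain ⟨ρ, hρ⟩ := S.exists_dist_pattern_le hV hne
  induction ξ using QuotientAddGroup.induction_on with
  | H z =>
    obtain ⟨x, ⟨g, hg, hgV⟩, -⟩ := hρ z.1 0
    refine ⟨z.1 + g, hgV, z.2 + x, ?_⟩
    rw [QuotientAddGroup.eq]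
    have e : -(z.1 + g, z.2 + x) + z = -(g, x) := Prod.ext (by simp) (by simp)
    rw [e]
    exact S.lattice.neg_mem hg

theorem mk_add_eq {h g : Space n × C} {x y : Space d} (hg : (g, y) ∈ S.lattice) :
    (((h + g, x + y) : (Space n × C) × Space d) : S.Torus) =
      ((h, x) : (Space n × C) × Space d) := by
  rw [QuotientAddGroup.eq]
  have e : -(h + g, x + y) + (h, x) = -(g, y) := Prod.ext (by simp) (by simp)
  rw [e]
  exact S.lattice.neg_mem hg

/-- By injectivity of the physical projection, the torus parameter and a physical coordinate
determine the internal coordinate. -/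
theorem eq_of_mk_eq {h h' : Space n × C} {x : Space d}
    (he : (((h, x) : (Space n × C) × Space d) : S.Torus) =
      ((h', x) : (Space n × C) × Space d)) : h = h' := by
  rw [QuotientAddGroup.eq] at he
  have e : -(h, x) + (h', x) = (-h + h', 0) := Prod.ext (by simp) (by simp)
  rw [e] at he
  have := S.eq_of_mem he S.lattice.zero_mem
  exact neg_add_eq_zero.1 this

/-- Two parameters of the same pattern differ by an internal shift `a = h' - h`. Points of the
pattern over the interior of `W` for `ξ` lie over `W` for `ζ`, so by density of the lattice `a` maps
`interior W` into `W`, whence `a = 0`. -/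
theorem torusGraph_unique {W : Set (Space n × C)} (hW : IsWindow W) {A : Set (Space d)}
    {ξ ζ : S.Torus} (h1 : (A, ξ) ∈ S.torusGraph W) (h2 : (A, ζ) ∈ S.torusGraph W) : ξ = ζ := by
  have hint : (interior W).Nonempty := by
    rw [← closure_nonempty_iff, hW.closure_interior]
    exact hW.nonempty
  have hcl : IsClosed {x : Space d | ∃ h ∈ W, ((h, x) : (Space n × C) × Space d) = ζ} :=
    (S.isClosed_setOf_exists_mem hW.isCompact).preimage
      (f := fun x => (ζ, x)) (by fun_prop)
  have hsub : ∀ h ∈ interior W, ∀ x : Space d, ((h, x) : (Space n × C) × Space d) = ξ →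
      ∃ h' ∈ W, ((h', x) : (Space n × C) × Space d) = ζ := fun h hh x hx =>
    closure_minimal h2.1 hcl (h1.2 h hh x hx)
  obtain ⟨h, hh, x, hx⟩ := S.exists_mk_eq isOpen_interior hint ξ
  obtain ⟨h', hh', hx'⟩ := hsub h hh x hx
  have ha : h' - h = 0 := by
    refine hW.eq_zero_of_forall_add_mem fun k hk => ?_
    by_contra hcon
    have hop : IsOpen {g : Space n × C | h + g ∈ interior W ∧ h' + g ∉ W} :=
      (isOpen_interior.preimage (by fun_prop)).inter
        (hW.isCompact.isClosed.isOpen_compl.preimage (by fun_prop))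
    obtain ⟨_, ⟨γ, hγ, rfl⟩, hg1, hg2⟩ := S.dense.exists_mem_open hop
      ⟨k - h, by simpa using hk, by
        have e : h' + (k - h) = k + (h' - h) := by abel
        rwa [e]⟩
    obtain ⟨h'', hh'', hx''⟩ := hsub (h + γ.1) hg1 (x + γ.2) ((S.mk_add_eq hγ).trans hx)
    have he := hx''.trans (hx'.symm.trans (S.mk_add_eq (h := h') (x := x) hγ).symm)
    rw [S.eq_of_mk_eq he] at hh''
    exact hg2 hh''
  rw [← hx, ← hx', sub_eq_zero.1 ha]

theorem vadd_mem_torusGraph {W : Set (Space n × C)} {A : Set (Space d)} {ξ : S.Torus}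
    (h : (A, ξ) ∈ S.torusGraph W) (y : Space d) :
    (y +ᵥ A, ξ + ((0, y) : (Space n × C) × Space d)) ∈ S.torusGraph W := by
  constructor
  · rintro _ ⟨x, hx, rfl⟩
    obtain ⟨k, hk, he⟩ := h.1 x hx
    refine ⟨k, hk, ?_⟩
    simp only at he ⊢
    rw [← he, ← QuotientAddGroup.mk_add]
    simp [add_comm]
  · intro k hk x hx
    simp only at hx ⊢
    rw [closure_vadd, mem_vadd_iff]
    refine h.2 k hk _ ?_
    rw [← sub_eq_iff_eq_add, ← QuotientAddGroup.mk_sub] at hx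
    simpa using hx

theorem pattern_mem_torusGraph {W V : Set (Space n × C)} (h1 : V ⊆ W) (h2 : interior W ⊆ V)
    (h : Space n × C) :
    (pattern S.lattice V h, (((h, 0) : (Space n × C) × Space d) : S.Torus)) ∈ S.torusGraph W := by
  constructor
  · rintro x ⟨g, hg, hgV⟩
    refine ⟨h + g, h1 hgV, ?_⟩
    simpa using S.mk_add_eq (h := h) (x := 0) hg
  · intro k hk x hx
    refine subset_closure ⟨k - h, ?_, h2 (by simpa using hk)⟩
    simp only at hx
    rw [eq_comm, QuotientAddGroup.eq] at hx
    have e : -(h, (0 : Space d)) + (k, x) = (k - h, x) :=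
      Prod.ext (by simp [sub_eq_neg_add]) (by simp)
    rwa [e] at hx

/-- The patterns that have a parameter form a closed set, as the projection of a closed set along
the compact torus, and this set is translation invariant. -/
theorem exists_mem_torusGraph_of_mem_hull {W : Set (Space n × C)} (hW : IsCompact W)
    {M A : Set (Space d)} {ξ : S.Torus} (hM : (M, ξ) ∈ S.torusGraph W) (hA : A ∈ hull M) :
    ∃ ζ, (A, ζ) ∈ S.torusGraph W := by
  have := S.cocompact
  have hcl : IsClosed (Prod.fst '' S.torusGraph W) :=
    isClosedMap_fst_of_compactSpace _ (S.isClosed_torusGraph hW)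
  have : A ∈ Prod.fst '' S.torusGraph W := by
    refine closure_minimal ?_ hcl hA
    rintro _ ⟨x, rfl⟩
    exact ⟨_, S.vadd_mem_torusGraph hM x, rfl⟩
  obtain ⟨⟨_, ζ⟩, h, rfl⟩ := this
  exact ⟨ζ, h⟩

/-- `MaxEquicontinuousRel` tests only factors in `Type`, while the torus lives in the universe of
`C`; finiteness of `C` makes it small. -/
instance : Small.{0} S.Torus :=
  small_of_surjective (QuotientAddGroup.mk_surjective (s := S.lattice))

/-- Two patterns with the same image in the maximal equicontinuous factor have the same torus
parameter. -/
theorem eq_of_maxEquicontinuousRel {W : Set (Space n × C)} (hW : IsWindow W)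
    {M A₁ A₂ : Set (Space d)} {ξ ξ₁ ξ₂ : S.Torus} (hM : (M, ξ) ∈ S.torusGraph W)
    (hsurj : ∀ ζ, ∃ A ∈ hull M, (A, ζ) ∈ S.torusGraph W)
    (h₁ : (A₁, ξ₁) ∈ S.torusGraph W) (h₂ : (A₂, ξ₂) ∈ S.torusGraph W)
    (h : MaxEquicontinuousRel M A₁ A₂) : ξ₁ = ξ₂ := by
  have := S.cocompact
  have := S.t2Space_torus
  let uT : UniformSpace S.Torus := IsTopologicalAddGroup.rightUniformSpace S.Torus
  choose p hp using fun A : hull M => S.exists_mem_torusGraph_of_mem_hull hW.isCompact hM A.2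
  -- Closed graph theorem with compact target.
  have hpc : Continuous p := by
    refine continuous_iff_isClosed.2 fun D hD => ?_
    have hcl : IsClosed (Prod.fst '' (S.torusGraph W ∩ Prod.snd ⁻¹' D)) :=
      isClosedMap_fst_of_compactSpace _
        ((S.isClosed_torusGraph hW.isCompact).inter (hD.preimage continuous_snd))
    convert hcl.preimage (continuous_subtype_val (p := fun A => A ∈ hull M)) using 1
    ext A
    constructor
    · exact fun hA => ⟨(A, p A), ⟨hp A, hA⟩, rfl⟩
    · rintro ⟨⟨B, ζ⟩, ⟨hB, hζ⟩, hBA⟩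
      simp only at hBA
      subst hBA
      rw [Set.mem_preimage, S.torusGraph_unique hW (hp A) hB]
      exact hζ
  -- The torus, with its uniformity and the translation action of `ℝ^d`, is transported to a copy in
  -- `Type`. Equicontinuity holds because translations preserve differences.
  let e : S.Torus ≃ Shrink.{0} S.Torus := equivShrink S.Torus
  let uY : UniformSpace (Shrink.{0} S.Torus) := UniformSpace.comap e.symm uT
  have hind : IsInducing e.symm := ⟨rfl⟩
  let eh : Shrink.{0} S.Torus ≃ₜ S.Torus := e.symm.toHomeomorphOfIsInducing hind
  have hce : Continuous e := eh.symm.continuous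
  have hce' : Continuous e.symm := eh.continuous
  have : CompactSpace (Shrink.{0} S.Torus) := eh.symm.compactSpace
  have : T2Space (Shrink.{0} S.Torus) := eh.isEmbedding.t2Space
  let act : AddAction (Space d) (Shrink.{0} S.Torus) :=
    { vadd := fun x y => e (e.symm y + (((0, x) : (Space n × C) × Space d) : S.Torus))
      zero_vadd := fun y => by
        change e (e.symm y + (((0, 0) : (Space n × C) × Space d) : S.Torus)) = y
        rw [Prod.mk_zero_zero, QuotientAddGroup.mk_zero, add_zero, Equiv.apply_symm_apply]
      add_vadd := fun x x' y => by
        change e _ = e (e.symm (e _) + _)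
        rw [Equiv.symm_apply_apply, add_assoc, ← QuotientAddGroup.mk_add]
        simp [add_comm] }
  have hact : ∀ (x : Space d) (y : Shrink.{0} S.Torus),
      x +ᵥ y = e (e.symm y + (((0, x) : (Space n × C) × Space d) : S.Torus)) := fun _ _ => rfl
  have : ContinuousVAdd (Space d) (Shrink.{0} S.Torus) := ⟨by
    refine hce.comp ((hce'.comp continuous_snd).add
      (QuotientAddGroup.continuous_mk.comp ?_))
    fun_prop⟩
  obtain ⟨hm₁, hm₂, H⟩ := h
  have key := H (Shrink.{0} S.Torus) (fun A => e (p A)) (hce.comp hpc)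
    (fun y => by
      obtain ⟨A, hA, hAy⟩ := hsurj (e.symm y)
      refine ⟨⟨A, hA⟩, ?_⟩
      simp only
      rw [S.torusGraph_unique hW (hp ⟨A, hA⟩) hAy, Equiv.apply_symm_apply])
    (fun x A B hAB => by
      rw [hact, Equiv.symm_apply_apply]
      congr 1
      refine S.torusGraph_unique hW (hp B) ?_
      rw [hAB]
      exact S.vadd_mem_torusGraph (hp A) x)
    (by
      intro U hU
      obtain ⟨V, hV, hVU⟩ := mem_comap.1 hU
      obtain ⟨N, hN, hNV⟩ := mem_comap.1 hV
      have : (Prod.map e.symm e.symm) ⁻¹' ((fun q : S.Torus × S.Torus => q.2 + -q.1) ⁻¹' N) ∈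
          𝓤 (Shrink.{0} S.Torus) := preimage_mem_comap (preimage_mem_comap hN)
      filter_upwards [this] with q hq x
      refine hVU (hNV ?_)
      simp only [Set.mem_preimage, Prod.map_fst, Prod.map_snd, hact, Equiv.symm_apply_apply] at hq ⊢
      convert hq using 1
      abel)
  have := e.injective key
  rw [S.torusGraph_unique hW h₁ (hp ⟨A₁, hm₁⟩), S.torusGraph_unique hW h₂ (hp ⟨A₂, hm₂⟩), this]

end CutProjectScheme

end Torus

/-! ### The transversal of a model set -/

theorem mem_localEntourage_of_agreeOn {d : ℕ} {R ε : ℝ} (hε : 0 ≤ ε) {A B : Set (Space d)}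
    (h : AgreeOn R A B) : (A, B) ∈ localEntourage d R ε :=
  ⟨fun a ha hR => ⟨a, (h.mem_iff hR).1 ha, by simpa using hε⟩,
    fun b hb hR => ⟨b, (h.mem_iff hR).2 hb, by simpa using hε⟩⟩

theorem mem_closure_of_forall_agreeOn {d : ℕ} {𝒜 : Set (Set (Space d))} {A : Set (Space d)}
    (h : ∀ R : ℝ, ∃ B ∈ 𝒜, AgreeOn R A B) : A ∈ closure 𝒜 := by
  rw [mem_closure_iff_nhds]
  intro U hU
  obtain ⟨V, hV, hVU⟩ := UniformSpace.mem_nhds_iff.1 hU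
  obtain ⟨R, ε, hε, hRV⟩ := exists_localEntourage_subset hV
  obtain ⟨B, hB, hAB⟩ := h R
  exact ⟨B, hVU (hRV (mem_localEntourage_of_agreeOn hε.le hAB)), hB⟩

theorem AgreeOn.vadd {d : ℕ} {K R : ℝ} {A B : Set (Space d)} (h : AgreeOn R A B) {z : Space d}
    (hK : K + ‖z‖ ≤ R) : AgreeOn K (z +ᵥ A) (z +ᵥ B) := by
  refine agreeOn_iff.2 fun x hx => ?_
  rw [mem_vadd_iff, mem_vadd_iff]
  exact h.mem_iff ((norm_sub_le x z).trans (by linarith))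

section Transversal

set_option linter.unusedSectionVars false

variable {d n : ℕ} {C : Type*} [AddCommGroup C] [TopologicalSpace C] [DiscreteTopology C]
    [Finite C] (S : CutProjectScheme d (Space n × C)) {Q : Set (Finset (Space n × ℝ) × C)}

namespace CutProjectScheme

/-- The patterns with generic direction that contain the origin. -/
def sidedPatterns (Q : Set (Finset (Space n × ℝ) × C)) : Set (Set (Space d)) :=
  {A | ∃ h u, IsGeneric Q u ∧ h ∈ sided Q u ∧ A = pattern S.lattice (sided Q u) h}

theorem zero_mem_of_mem_sidedPatterns {A : Set (Space d)} (hA : A ∈ S.sidedPatterns Q) :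
    (0 : Space d) ∈ A := by
  obtain ⟨h, u, -, hh, rfl⟩ := hA
  exact S.zero_mem_pattern_iff.2 hh

theorem neg_vadd_mem_sidedPatterns {A : Set (Space d)} (hA : A ∈ S.sidedPatterns Q) {y : Space d}
    (hy : y ∈ A) : (-y) +ᵥ A ∈ S.sidedPatterns Q := by
  obtain ⟨h, u, hu, hh, rfl⟩ := hA
  obtain ⟨g, hg, hgV⟩ := hy
  exact ⟨h + g, u, hu, hgV, S.neg_vadd_pattern hg⟩

theorem isClosed_of_subset_boundedPoints {r : ℝ} {A : Set (Space d)}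
    (hA : A ⊆ S.boundedPoints r) : IsClosed A := by
  refine isClosed_of_closure_subset fun a ha => ?_
  have hfin : (A ∩ Metric.closedBall 0 (‖a‖ + 1)).Finite :=
    (S.finite_boundedPoints_inter r (‖a‖ + 1)).subset (Set.inter_subset_inter_left _ hA)
  have hball : Metric.ball a 1 ⊆ Metric.closedBall 0 (‖a‖ + 1) := fun x hx => by
    rw [mem_closedBall_zero_iff]
    have := norm_le_norm_add_norm_sub' x a
    rw [← dist_eq_norm] at this
    linarith [Metric.mem_ball.1 hx]
  have : a ∈ closure (A ∩ Metric.closedBall 0 (‖a‖ + 1)) := by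
    rw [Metric.mem_closure_iff] at ha ⊢
    intro ε hε
    obtain ⟨b, hb, hab⟩ := ha (min ε 1) (by positivity)
    refine ⟨b, ⟨hb, hball ?_⟩, hab.trans_le (min_le_left _ _)⟩
    rw [Metric.mem_ball, dist_comm]
    exact hab.trans_le (min_le_right _ _)
  rw [hfin.isClosed.closure_eq] at this
  exact this.1

theorem subset_boundedPoints_of_mem_closure {r : ℝ} {𝒜 : Set (Set (Space d))}
    (h𝒜 : ∀ B ∈ 𝒜, B ⊆ S.boundedPoints r) {A : Set (Space d)} (hA : A ∈ closure 𝒜) :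
    A ⊆ S.boundedPoints r := by
  intro a ha
  rw [← (S.isClosed_of_subset_boundedPoints (subset_refl (S.boundedPoints r))).closure_eq,
    Metric.mem_closure_iff]
  intro ε hε
  obtain ⟨B, hB, h⟩ := exists_mem_localEntourage_of_mem_closure hA ‖a‖ (half_pos hε)
  obtain ⟨b, hb, hab⟩ := h.1 a ha le_rfl
  exact ⟨b, h𝒜 B hB hb, by linarith⟩

theorem exists_agreeOn_of_mem_closure {r : ℝ} {𝒜 : Set (Set (Space d))}
    (h𝒜 : ∀ B ∈ 𝒜, B ⊆ S.boundedPoints r) {A : Set (Space d)} (hA : A ∈ closure 𝒜) (K : ℝ) :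
    ∃ B ∈ 𝒜, AgreeOn K A B := by
  obtain ⟨ε, hε, h⟩ := S.exists_agreeOn_of_close r K
  obtain ⟨B, hB, hAB⟩ := exists_mem_localEntourage_of_mem_closure hA K hε
  exact ⟨B, hB, h A B (S.subset_boundedPoints_of_mem_closure h𝒜 hA) (h𝒜 B hB) hAB⟩

/-- The family of all translates of `M` that contain the origin, whose closure is the
transversal, is uniformly locally finite. -/
theorem neg_vadd_subset_boundedPoints {W : Set (Space n × C)} {r : ℝ} (hr : ∀ v ∈ W, ‖v.1‖ ≤ r)
    {M : Set (Space d)} {ξ : S.Torus} (hM : (M, ξ) ∈ S.torusGraph W) {m : Space d} (hm : m ∈ M) :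
    (-m) +ᵥ M ⊆ S.boundedPoints (r + r) := by
  rintro _ ⟨x, hx, rfl⟩
  obtain ⟨h, hh, he⟩ := hM.1 x hx
  obtain ⟨k, hk, he'⟩ := hM.1 m hm
  have := he'.trans he.symm
  rw [QuotientAddGroup.eq] at this
  refine ⟨-k + h, by simpa using this, ?_⟩
  rw [← sub_eq_neg_add]
  exact (norm_sub_le _ _).trans (add_le_add (hr h hh) (hr k hk))

/-- Translates of the nonsingular projection set approximate `M`. Recentring both at nearby points
puts them into one locally finite set, where approximation becomes exact agreement. -/
theorem IsModelSet.exists_agreeOn_pattern {W : Set (Space n × C)} {r : ℝ}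
    (hr : ∀ v ∈ W, ‖v.1‖ ≤ r) {M : Set (Space d)} (hM : S.IsModelSet W M) {ξ : S.Torus}
    (hMξ : (M, ξ) ∈ S.torusGraph W) {m : Space d} (hm : m ∈ M) (K : ℝ) :
    ∃ k, (∀ g x, (g, x) ∈ S.lattice → k + g ∉ frontier W) ∧
      AgreeOn K ((-m) +ᵥ M) (pattern S.lattice W k) := by
  obtain ⟨ζ, hζ, hMζ⟩ := hM
  induction ζ using QuotientAddGroup.induction_on with
  | H z =>
  obtain ⟨k₀, y⟩ := z
  obtain ⟨ε, hε, hclose⟩ := S.exists_agreeOn_of_close (r + r) K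
  -- The radius allows for recentring at `m` or at the nearby `m'`. The point error and the
  -- recentring error are at most `ε / 2` each.
  obtain ⟨_, ⟨z, rfl⟩, hag⟩ := exists_mem_localEntourage_of_mem_closure hMζ (K + ‖m‖ + ε)
    (half_pos hε)
  rw [S.projectionSet_mk, vadd_vadd] at hag
  have hK : ‖m‖ ≤ |K| + ‖m‖ + ε := by
    have := abs_nonneg K
    linarith
  by_cases hK0 : 0 ≤ K
  · obtain ⟨m', hm', hmm'⟩ := hag.1 m hm (by linarith)
    obtain ⟨g, hg, hgW⟩ := mem_vadd_iff.1 hm'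
    have hB : (-m') +ᵥ ((z + y) +ᵥ pattern S.lattice W k₀) = pattern S.lattice W (k₀ + g) := by
      rw [← S.neg_vadd_pattern hg, vadd_vadd]
      congr 1
      abel
    refine ⟨k₀ + g, fun g' x hg' => ?_, ?_⟩
    · rw [add_assoc]
      exact S.isNonsingular_mk hζ (S.lattice.add_mem hg hg')
    · have hsub : pattern S.lattice W (k₀ + g) ⊆ S.boundedPoints (r + r) := by
        rintro x ⟨g', hg', h'⟩
        refine ⟨g', hg', ?_⟩
        have e : g' = (k₀ + g + g') - (k₀ + g) := by abel
        rw [e]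
        exact (norm_sub_le _ _).trans (add_le_add (hr _ h') (hr _ hgW))
      refine hclose _ _ (S.neg_vadd_subset_boundedPoints hr hMξ hm) hsub ?_
      rw [← hB]
      have hd : ∀ a b : Space d, dist a b ≤ ε / 2 → dist (-m + a) (-m' + b) ≤ ε := by
        intro a b hab
        have := dist_add_add_le (-m) a (-m') b
        rw [dist_neg_neg] at this
        linarith
      constructor
      · rintro _ ⟨a, ha, rfl⟩ hn
        simp only [vadd_eq_add] at hn
        obtain ⟨b, hb, hab⟩ := hag.1 a ha (by
          have := norm_add_le m (-m + a)
          rw [add_neg_cancel_left] at this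
          linarith)
        exact ⟨-m' + b, Set.vadd_mem_vadd_set hb, hd a b hab⟩
      · rintro _ ⟨b, hb, rfl⟩ hn
        simp only [vadd_eq_add] at hn
        obtain ⟨a, ha, hab⟩ := hag.2 b hb (by
          have h1 := norm_add_le m' (-m' + b)
          rw [add_neg_cancel_left] at h1
          have h2 := norm_le_norm_add_norm_sub' m' m
          rw [← dist_eq_norm, dist_comm] at h2
          linarith)
        refine ⟨-m + a, Set.vadd_mem_vadd_set ha, ?_⟩
        rw [dist_comm]
        exact hd a b (by rwa [dist_comm])
  -- For `K < 0` the ball is empty.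
  · refine ⟨k₀, fun g x hg => S.isNonsingular_mk hζ hg, agreeOn_iff.2 fun x hx => ?_⟩
    exact absurd ((norm_nonneg x).trans hx) hK0

theorem IsModelSet.exists_mem_torusGraph {W : Set (Space n × C)} (hW : IsCompact W)
    {M : Set (Space d)} (hM : S.IsModelSet W M) : ∃ ξ, (M, ξ) ∈ S.torusGraph W := by
  obtain ⟨ζ, -, hMζ⟩ := hM
  induction ζ using QuotientAddGroup.induction_on with
  | H z =>
  obtain ⟨k₀, y⟩ := z
  rw [S.projectionSet_mk] at hMζ
  exact S.exists_mem_torusGraph_of_mem_hull hW (S.vadd_mem_torusGraph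
    (S.pattern_mem_torusGraph subset_rfl interior_subset k₀) y) hMζ

theorem nonempty_of_mem_torusGraph {W : Set (Space n × C)} (hW : IsWindow W) {M : Set (Space d)}
    {ξ : S.Torus} (hM : (M, ξ) ∈ S.torusGraph W) : M.Nonempty := by
  have hint : (interior W).Nonempty := by
    rw [← closure_nonempty_iff, hW.closure_interior]
    exact hW.nonempty
  obtain ⟨h, hh, x, hx⟩ := S.exists_mk_eq isOpen_interior hint ξ
  exact closure_nonempty_iff.1 ⟨x, hM.2 h hh x hx⟩

/-- A nonsingular pattern is the same for every direction, since all `sided Q u` lie between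
`interior W` and `W`; and limits of generic patterns are generic by `exists_eq_pattern`. Conversely,
`exists_agreeOn_pattern_add` finds every generic pattern among the limits of translates of any other
one: the system is minimal. -/
theorem IsModelSet.transversal_eq (hQ : Q.Finite) (hW : IsWindow (sided Q 0)) {M : Set (Space d)}
    (hM : S.IsModelSet (sided Q 0) M) : transversal M = S.sidedPatterns Q := by
  obtain ⟨r, hr⟩ : ∃ r, ∀ v ∈ sided Q 0, ‖v.1‖ ≤ r :=
    hW.isCompact.exists_bound_of_continuousOn continuous_fst.continuousOn
  obtain ⟨ξ, hξ⟩ := IsModelSet.exists_mem_torusGraph S hW.isCompact hM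
  obtain ⟨w, hw⟩ := exists_isGeneric hQ
  have hsub : transversal M ⊆ S.sidedPatterns Q := by
    intro A hA
    have hb : ∀ B ∈ {A | ∃ x ∈ M, A = (-x) +ᵥ M}, B ⊆ S.boundedPoints (r + r) := by
      rintro _ ⟨m, hm, rfl⟩
      exact S.neg_vadd_subset_boundedPoints hr hξ hm
    have happ : ∀ K : ℝ, ∃ m ∈ M, AgreeOn K A ((-m) +ᵥ M) := by
      intro K
      obtain ⟨_, ⟨m, hm, rfl⟩, h⟩ := S.exists_agreeOn_of_mem_closure hb hA K
      exact ⟨m, hm, h⟩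
    have h0 : (0 : Space d) ∈ A := by
      obtain ⟨m, hm, h⟩ := happ 0
      exact (h.mem_iff (by simp)).2 (mem_vadd_iff.2 (by simpa using hm))
    obtain ⟨h, u, hu, rfl⟩ := S.exists_eq_pattern hQ hW.isCompact h0 fun K => by
      obtain ⟨m, hm, h⟩ := happ K
      obtain ⟨k, hk, h'⟩ := IsModelSet.exists_agreeOn_pattern S hr hM hξ hm K
      -- The direction `w` is arbitrary: a nonsingular parameter keeps all internal coordinates off
      -- the frontier of the window.
      refine ⟨k, w, hw, h.trans (h'.trans ?_)⟩
      refine agreeOn_iff.2 fun x _ => exists_congr fun g => and_congr_right fun hg => ?_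
      refine ⟨fun hmem => interior_subset_sided hQ w ?_, fun hmem => sided_subset w hmem⟩
      by_contra hcon
      exact hk g x hg ⟨subset_closure hmem, hcon⟩
    exact ⟨h, u, hu, S.zero_mem_pattern_iff.1 h0, rfl⟩
  refine Set.Subset.antisymm hsub ?_
  rintro _ ⟨h, u, hu, hh, rfl⟩
  obtain ⟨m, hm⟩ := S.nonempty_of_mem_torusGraph hW hξ
  obtain ⟨h₀, u₀, hu₀, -, he⟩ := hsub (subset_closure ⟨m, hm, rfl⟩)
  refine mem_closure_of_forall_agreeOn fun R => ?_
  obtain ⟨g, x, hg, hag⟩ := S.exists_agreeOn_pattern_add hQ hr hu h h₀ (max R 0)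
  have hx0 : h₀ + g ∈ sided Q u₀ := by
    rw [← S.zero_mem_pattern_iff, (hag u₀).mem_iff (by simp), S.zero_mem_pattern_iff]
    exact hh
  have hxM : x ∈ (-m) +ᵥ M := by
    rw [he]
    exact ⟨g, hg, hx0⟩
  refine ⟨_, ⟨m + x, ?_, rfl⟩, ?_⟩
  · rw [mem_vadd_iff] at hxM
    rwa [sub_neg_eq_add, add_comm] at hxM
  · have e : (-(m + x)) +ᵥ M = pattern S.lattice (sided Q u₀) (h₀ + g) := by
      rw [← S.neg_vadd_pattern hg, ← he, vadd_vadd]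
      congr 1
      abel
    rw [e]
    exact (hag u₀).symm.mono (le_max_left _ _)

/-- Every torus element has a representative `(h, z)` with `h` in the interior of the window; the
generic pattern at `h` is in the transversal, and its translate by `z` has the required parameter.
-/
theorem IsModelSet.exists_mem_hull_mem_torusGraph (hQ : Q.Finite) (hW : IsWindow (sided Q 0))
    {M : Set (Space d)} (hM : S.IsModelSet (sided Q 0) M) (ζ : S.Torus) :
    ∃ A ∈ hull M, (A, ζ) ∈ S.torusGraph (sided Q 0) := by
  have hint : (interior (sided Q 0)).Nonempty := by
    rw [← closure_nonempty_iff, hW.closure_interior]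
    exact hW.nonempty
  obtain ⟨u, hu⟩ := exists_isGeneric hQ
  obtain ⟨h, hh, z, rfl⟩ := S.exists_mk_eq isOpen_interior hint ζ
  have hP : pattern S.lattice (sided Q u) h ∈ transversal M := by
    rw [IsModelSet.transversal_eq S hQ hW hM]
    exact ⟨h, u, hu, interior_subset_sided hQ u hh, rfl⟩
  obtain ⟨r, hr⟩ : ∃ r, ∀ v ∈ sided Q 0, ‖v.1‖ ≤ r :=
    hW.isCompact.exists_bound_of_continuousOn continuous_fst.continuousOn
  obtain ⟨ξ, hξ⟩ := IsModelSet.exists_mem_torusGraph S hW.isCompact hM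
  refine ⟨z +ᵥ pattern S.lattice (sided Q u) h, mem_closure_of_forall_agreeOn fun R => ?_, ?_⟩
  · have hb : ∀ B ∈ {A | ∃ x ∈ M, A = (-x) +ᵥ M}, B ⊆ S.boundedPoints (r + r) := by
      rintro _ ⟨m, hm, rfl⟩
      exact S.neg_vadd_subset_boundedPoints hr hξ hm
    obtain ⟨_, ⟨m, -, rfl⟩, hag⟩ := S.exists_agreeOn_of_mem_closure hb hP (R + ‖z‖)
    exact ⟨_, ⟨z + -m, rfl⟩, by
      rw [← vadd_vadd]
      exact hag.vadd le_rfl⟩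
  · have := S.vadd_mem_torusGraph
      (S.pattern_mem_torusGraph (sided_subset u) (interior_subset_sided hQ u) h) z
    rw [← QuotientAddGroup.mk_add] at this
    simpa using this

/-- The patterns contained in a uniformly locally finite set form a compact set. -/
theorem isCompact_powerset_boundedPoints (r : ℝ) : IsCompact (𝒫 (S.boundedPoints r)) := by
  -- Subsets are indicator functions, and the cube of all indicator functions is compact. Continuity
  -- holds because a ball contains only finitely many of the points.
  let f : (S.boundedPoints r → Bool) → Set (Space d) := fun χ => {x | ∃ h, χ ⟨x, h⟩ = true}
  have hf : Continuous f := by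
    rw [continuous_iff_continuousAt]
    intro χ U hU
    obtain ⟨V, hV, hVU⟩ := UniformSpace.mem_nhds_iff.1 hU
    obtain ⟨R, ε, hε, hRV⟩ := exists_localEntourage_subset hV
    have hfin : {x : S.boundedPoints r | ‖(x : Space d)‖ ≤ R}.Finite := by
      refine Set.Finite.of_finite_image ((S.finite_boundedPoints_inter r R).subset ?_)
        Subtype.val_injective.injOn
      rintro _ ⟨x, hx, rfl⟩
      exact ⟨x.2, by simpa using hx⟩
    have hev : ∀ᶠ χ' in 𝓝 χ, ∀ x ∈ {x : S.boundedPoints r | ‖(x : Space d)‖ ≤ R},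
        χ' x = χ x :=
      (eventually_all_finite hfin).2 fun x _ =>
        (continuous_apply x).continuousAt.preimage_mem_nhds
          ((isOpen_discrete {χ x}).mem_nhds rfl)
    refine hev.mono fun χ' hχ' => ?_
    refine hVU (hRV (mem_localEntourage_of_agreeOn hε.le (agreeOn_iff.2 fun x hx => ?_)))
    exact exists_congr fun h => by rw [hχ' ⟨x, h⟩ hx]
  classical
  have : 𝒫 (S.boundedPoints r) = Set.range f := by
    ext A
    constructor
    · intro hA
      refine ⟨fun x => decide ((x : Space d) ∈ A), ?_⟩
      ext x
      exact ⟨fun ⟨_, h⟩ => of_decide_eq_true h, fun h => ⟨hA h, decide_eq_true h⟩⟩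
    · rintro ⟨χ, rfl⟩ x ⟨h, -⟩
      exact h
  rw [this]
  exact isCompact_range hf

/-- The transversal of a model set is compact. -/
theorem IsModelSet.isCompact_transversal {W : Set (Space n × C)} (hW : IsCompact W)
    {M : Set (Space d)} (hM : S.IsModelSet W M) : IsCompact (transversal M) := by
  obtain ⟨r, hr⟩ : ∃ r, ∀ v ∈ W, ‖v.1‖ ≤ r :=
    hW.exists_bound_of_continuousOn continuous_fst.continuousOn
  obtain ⟨ξ, hξ⟩ := IsModelSet.exists_mem_torusGraph S hW hM
  refine (S.isCompact_powerset_boundedPoints (r + r)).closure_of_subset ?_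
  rintro _ ⟨m, hm, rfl⟩
  exact S.neg_vadd_subset_boundedPoints hr hξ hm

end CutProjectScheme

end Transversal

/-! ### Functions with pattern equivariant coboundary along paths -/

/-- A translation invariant family of locally finite patterns that contain the origin and are
relatively dense with radius `ρ`. -/
structure IsPatternFamily {d : ℕ} (Ξ : Set (Set (Space d))) (ρ : ℝ) : Prop where
  zero_mem : ∀ A ∈ Ξ, (0 : Space d) ∈ A
  neg_vadd_mem : ∀ A ∈ Ξ, ∀ y ∈ A, (-y) +ᵥ A ∈ Ξ
  finite : ∀ A ∈ Ξ, ∀ K : ℝ, (A ∩ Metric.closedBall 0 K).Finite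
  exists_dist_le : ∀ A ∈ Ξ, ∀ c : Space d, ∃ z ∈ A, dist c z ≤ ρ

/-- The increment of `g` along an edge of a pattern in `Ξ` only depends on the pattern within
distance `R`. -/
def HasLocalIncrements {d : ℕ} (Ξ : Set (Set (Space d))) (g : Set (Space d) → ℝ) (R : ℝ) : Prop :=
  ∀ A ∈ Ξ, ∀ B ∈ Ξ, ∀ z : Space d, IsEdge A 0 z → AgreeOn R A B →
    g ((-z) +ᵥ A) - g A = g ((-z) +ᵥ B) - g B

theorem AgreeOn.of_neg_vadd {d : ℕ} {R R' : ℝ} {A B : Set (Space d)} {x y : Space d}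
    (h : AgreeOn R ((-y) +ᵥ A) ((-y) +ᵥ B)) (hR : R' + dist x y ≤ R) :
    AgreeOn R' ((-x) +ᵥ A) ((-x) +ᵥ B) := by
  have := h.vadd (z := -x + y) (K := R') (by rwa [neg_add_eq_sub, ← dist_eq_norm, dist_comm])
  simpa [vadd_vadd] using this

theorem AgreeOn.mem_iff_of_dist_le {d : ℕ} {R : ℝ} {A B : Set (Space d)} {x y : Space d}
    (h : AgreeOn R ((-y) +ᵥ A) ((-y) +ᵥ B)) (hR : dist x y ≤ R) : x ∈ A ↔ x ∈ B := by
  have := h.mem_iff (x := x - y) (by rwa [← dist_eq_norm])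
  rwa [mem_vadd_iff, mem_vadd_iff, sub_neg_eq_add, sub_add_cancel] at this

namespace IsPatternFamily

variable {d : ℕ} {Ξ : Set (Set (Space d))} {ρ : ℝ} {g : Set (Space d) → ℝ} {R₀ : ℝ}

/-- Two close points are joined by a path of edges that stays nearby. -/
theorem exists_sub_eq_of_dist_le (hΞ : IsPatternFamily Ξ ρ) (hg : HasLocalIncrements Ξ g R₀)
    (L : ℝ) : ∃ R : ℝ, ∀ A ∈ Ξ, ∀ B ∈ Ξ, ∀ x ∈ A, ∀ y ∈ A, dist x y ≤ L →
      AgreeOn R ((-y) +ᵥ A) ((-y) +ᵥ B) →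
      x ∈ B ∧ g ((-x) +ᵥ A) - g ((-x) +ᵥ B) = g ((-y) +ᵥ A) - g ((-y) +ᵥ B) := by
  refine ⟨|R₀| + L, fun A hA B hB x hx y hy => ?_⟩
  have hfin : ∀ r : ℝ, {z | z ∈ A ∧ dist z y < r}.Finite := fun r =>
    (hΞ.finite A hA (r + ‖y‖)).subset fun z hz => ⟨hz.1, by
      have := norm_le_norm_add_norm_sub' z y
      rw [← dist_eq_norm] at this
      rw [mem_closedBall_zero_iff]
      linarith [hz.2]⟩
  generalize hN : {z | z ∈ A ∧ dist z y < dist x y}.ncard = N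
  intro hL hag
  have hxB : x ∈ B := (hag.mem_iff_of_dist_le (hL.trans (by linarith [abs_nonneg R₀]))).1 hx
  refine ⟨hxB, ?_⟩
  induction N using Nat.strong_induction_on generalizing x with
  | _ N ih =>
    by_cases hxy : x = y
    · rw [hxy]
    obtain ⟨z, hz, hzy⟩ := exists_isEdge_dist_lt (hΞ.finite A hA) hx hy hxy
    have hzA : z ∈ A := hz.2.1
    have hzL : dist z y ≤ L := hzy.le.trans hL
    have hzB : z ∈ B := (hag.mem_iff_of_dist_le (hzL.trans (by linarith [abs_nonneg R₀]))).1 hzA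
    have hlt : {w | w ∈ A ∧ dist w y < dist z y}.ncard < N := by
      rw [← hN]
      refine Set.ncard_lt_ncard ?_ (hfin _)
      refine Set.ssubset_iff_subset_ne.2 ⟨fun w hw => ⟨hw.1, hw.2.trans hzy⟩, fun he => ?_⟩
      have : z ∈ {w | w ∈ A ∧ dist w y < dist z y} := he ▸ ⟨hzA, hzy⟩
      exact lt_irrefl _ this.2
    rw [← ih _ hlt z hzA rfl hzL hzB]
    have hedge := hz.vadd (-x)
    rw [neg_add_cancel] at hedge
    have := hg _ (hΞ.neg_vadd_mem A hA x hx) _ (hΞ.neg_vadd_mem B hB x hxB) _ hedge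
      (hag.of_neg_vadd (by linarith [le_abs_self R₀]))
    simp only [vadd_vadd, neg_add_rev, neg_neg, add_assoc, add_neg_cancel, add_zero] at this
    linarith

/-- Transport along a segment, in a neighbourhood of which the two patterns agree. -/
theorem exists_sub_eq_of_segment (hΞ : IsPatternFamily Ξ ρ) (hg : HasLocalIncrements Ξ g R₀) :
    ∃ R : ℝ, 0 ≤ R ∧ ∀ A ∈ Ξ, ∀ B ∈ Ξ, ∀ p : Space d,
      (∀ t : ℝ, 0 ≤ t → t ≤ 1 → AgreeOn R ((-(t • p)) +ᵥ A) ((-(t • p)) +ᵥ B)) →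
      ∀ y ∈ A, dist y p ≤ ρ → y ∈ B ∧ g ((-y) +ᵥ A) - g ((-y) +ᵥ B) = g A - g B := by
  -- The segment is divided into steps of length at most `1`. Pattern points within `ρ` of
  -- consecutive division points are at most `2 * ρ + 1` apart; the extra `|ρ|` below recentres from
  -- a division point to such a pattern point.
  obtain ⟨R, hR⟩ := hΞ.exists_sub_eq_of_dist_le hg (2 * ρ + 1)
  refine ⟨|R| + |ρ|, by positivity, fun A hA B hB p hag => ?_⟩
  obtain ⟨N, hN⟩ := exists_nat_gt ‖p‖
  have hN0 : (0 : ℝ) < N := (norm_nonneg p).trans_lt hN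
  have key : ∀ i : ℕ, i ≤ N → ∀ y ∈ A, dist y (((i : ℝ) / N) • p) ≤ ρ →
      y ∈ B ∧ g ((-y) +ᵥ A) - g ((-y) +ᵥ B) = g A - g B := by
    intro i
    induction i with
    | zero =>
      intro _ y hy hyp
      have h0 := hag 0 le_rfl zero_le_one
      have hρ0 : 0 ≤ ρ := dist_nonneg.trans hyp
      simp only [Nat.cast_zero, zero_div, zero_smul] at hyp h0
      have := hR A hA B hB y hy 0 (hΞ.zero_mem A hA) (by linarith)
        (h0.mono (by linarith [le_abs_self R, abs_nonneg ρ]))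
      simpa using this
    | succ i ih =>
      intro hi y hy hyp
      have hρ0 : 0 ≤ ρ := dist_nonneg.trans hyp
      obtain ⟨x, hx, hxp⟩ := hΞ.exists_dist_le A hA (((i : ℝ) / N) • p)
      obtain ⟨hxB, he⟩ := ih (by omega) x hx (by rwa [dist_comm])
      have ht : ((i : ℝ) / N) ≤ 1 := by
        rw [div_le_one hN0]
        exact_mod_cast (by omega : i ≤ N)
      have hstep : dist (((i : ℝ) / N) • p) ((((i + 1 : ℕ) : ℝ) / N) • p) ≤ 1 := by
        rw [dist_eq_norm, ← sub_smul, norm_smul, ← sub_div]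
        push_cast
        rw [show (i : ℝ) - (i + 1) = -1 by ring, norm_div, norm_neg, norm_one,
          Real.norm_of_nonneg hN0.le, one_div, inv_mul_le_iff₀ hN0, mul_one]
        exact hN.le
      have hxy : dist y x ≤ 2 * ρ + 1 := by
        have h1 := dist_triangle y ((((i + 1 : ℕ) : ℝ) / N) • p) x
        have h2 := dist_triangle ((((i + 1 : ℕ) : ℝ) / N) • p) (((i : ℝ) / N) • p) x
        rw [dist_comm] at hstep
        linarith
      have hagx : AgreeOn R ((-x) +ᵥ A) ((-x) +ᵥ B) :=
        (hag _ (by positivity) ht).of_neg_vadd (by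
          rw [dist_comm]
          linarith [le_abs_self R, le_abs_self ρ])
      obtain ⟨hyB, he'⟩ := hR A hA B hB y hy x hx hxy hagx
      exact ⟨hyB, he'.trans he⟩
  intro y hy hyp
  refine key N le_rfl y hy ?_
  rwa [div_self hN0.ne', one_smul]

end IsPatternFamily

/-! ### Extending the function and its coboundary to the transversal. -/

open Classical in
/-- The extension by zero of a function on the transversal to all patterns. -/
noncomputable def transversalExtend {d : ℕ} {M : Set (Space d)} (G : transversal M → ℝ)
    (A : Set (Space d)) : ℝ :=
  if h : A ∈ transversal M then G ⟨A, h⟩ else 0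

theorem transversalExtend_apply {d : ℕ} {M : Set (Space d)} (G : transversal M → ℝ)
    (A : transversal M) : transversalExtend G A = G A := by
  simp [transversalExtend]

/-- Uniform continuity on a compact transversal. -/
theorem exists_abs_transversalExtend_sub_lt {d : ℕ} {M : Set (Space d)}
    (hM : IsCompact (transversal M)) {G : transversal M → ℝ} (hG : Continuous G) {η : ℝ}
    (hη : 0 < η) : ∃ K : ℝ, ∀ A ∈ transversal M, ∀ B ∈ transversal M, AgreeOn K A B →
      |transversalExtend G A - transversalExtend G B| < η := by
  have := isCompact_iff_compactSpace.1 hM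
  have hu := CompactSpace.uniformContinuous_of_continuous hG
  have hmem := hu (Metric.dist_mem_uniformity hη)
  obtain ⟨V, hV, hVU⟩ := mem_comap.1 hmem
  obtain ⟨K, ε, hε, hKV⟩ := exists_localEntourage_subset hV
  refine ⟨K, fun A hA B hB hAB => ?_⟩
  have := @hVU (⟨A, hA⟩, ⟨B, hB⟩) (hKV (mem_localEntourage_of_agreeOn hε.le hAB))
  rw [transversalExtend_apply G ⟨A, hA⟩, transversalExtend_apply G ⟨B, hB⟩, ← Real.dist_eq]
  exact this

/-- A strongly pattern equivariant coboundary extends to the transversal. -/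
theorem exists_hasLocalIncrements {d : ℕ} {M : Set (Space d)} {ρ : ℝ}
    (hΞ : IsPatternFamily (transversal M) ρ)
    (happ : ∀ A ∈ transversal M, ∀ K : ℝ, ∃ m ∈ M, AgreeOn K A ((-m) +ᵥ M))
    (hM : IsCompact (transversal M)) {F : M → ℝ} {G : transversal M → ℝ}
    (hG : IsTransversalExtension M F G)
    (hδ : StronglyPatternEquivariantOnEdges M (coboundary F)) :
    ∃ R, HasLocalIncrements (transversal M) (transversalExtend G) R := by
  obtain ⟨R₀, hR₀, hδ⟩ := hδ
  -- Radius `2 * ρ` carries the edge from `A` to `B` and to the translates of `M` approximating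
  -- them; radius `R₀` makes the values of the coboundary equal.
  refine ⟨max R₀ (2 * ρ), fun A hA B hB z hz hAB => ?_⟩
  have hρA := hΞ.exists_dist_le A hA
  have hzA := hz.dist_le hρA
  rw [dist_zero_left] at hzA
  have hzAB : z ∈ B := (hAB.mem_iff (hzA.trans (le_max_right _ _))).1 hz.2.1
  have hA' := hΞ.neg_vadd_mem A hA z hz.2.1
  have hB' := hΞ.neg_vadd_mem B hB z hzAB
  have hF : ∀ m : M, F m = transversalExtend G ((-(m : Space d)) +ᵥ M) := fun m =>
    (hG.2 m).trans (transversalExtend_apply G ⟨_, subset_closure ⟨m, m.2, rfl⟩⟩).symm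
  refine eq_of_abs_sub_le_all fun η hη => ?_
  -- An increment involves two values of the extension and two increments are compared, hence `η /
  -- 4`.
  obtain ⟨K, hK⟩ := exists_abs_transversalExtend_sub_lt hM hG.1 (show 0 < η / 4 by positivity)
  have hstep : ∀ D ∈ transversal M, z ∈ D → (-z) +ᵥ D ∈ transversal M →
      AgreeOn (max R₀ (2 * ρ)) A D →
      ∃ (m : M) (hm : (m : Space d) + z ∈ M), IsEdge M m (m + z) ∧
        AgreeOn R₀ D ((-(m : Space d)) +ᵥ M) ∧
        |(transversalExtend G ((-z) +ᵥ D) - transversalExtend G D) -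
          coboundary F m ⟨m + z, hm⟩| ≤ η / 2 := by
    intro D hD hzD hD' hAD
    obtain ⟨m, hm, hag⟩ := happ D hD (max R₀ (2 * ρ) + |K| + ‖z‖)
    have hle1 : R₀ ≤ max R₀ (2 * ρ) := le_max_left _ _
    have hle2 : 2 * ρ ≤ max R₀ (2 * ρ) := le_max_right _ _
    have hKa := le_abs_self K
    have hK0 := abs_nonneg K
    have hz0 := norm_nonneg z
    have hmz : m + z ∈ M := by
      have := (hag.mem_iff (x := z) (by linarith)).1 hzD
      rwa [mem_vadd_iff, sub_neg_eq_add, add_comm] at this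
    have hedge : IsEdge ((-m) +ᵥ M) 0 z := hz.of_agree hρA fun x hx => by
      rw [dist_zero_right] at hx
      exact (hAD.mem_iff (by linarith)).trans (hag.mem_iff (by linarith))
    have hedge' := hedge.vadd m
    rw [vadd_vadd, add_neg_cancel, zero_vadd, add_zero] at hedge'
    refine ⟨⟨m, hm⟩, hmz, hedge', hag.mono (by linarith), ?_⟩
    have h1 := hK D hD _ (subset_closure ⟨m, hm, rfl⟩) (hag.mono (by linarith))
    have e : (-z) +ᵥ ((-m) +ᵥ M) = (-(m + z)) +ᵥ M := by
      rw [vadd_vadd]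
      congr 1
      abel
    have h2 := hK ((-z) +ᵥ D) hD' _ (subset_closure ⟨m + z, hmz, rfl⟩) (by
      rw [← e]
      exact hag.vadd (by rw [norm_neg]; linarith))
    simp only [coboundary, hF]
    rw [abs_lt] at h1 h2
    rw [abs_le]
    constructor <;> linarith [h1.1, h1.2, h2.1, h2.2]
  obtain ⟨m, hm, he, hag, habs⟩ := hstep A hA hz.2.1 hA' rfl
  obtain ⟨m', hm', he', hag', habs'⟩ := hstep B hB hzAB hB' hAB
  have hco := hδ m ⟨m + z, hm⟩ m' ⟨m' + z, hm'⟩ he he' (by simp)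
    (hag.symm.trans ((hAB.mono (le_max_left _ _)).trans hag'))
  rw [← hco] at habs'
  rw [abs_le] at habs habs' ⊢
  constructor <;> linarith [habs.1, habs.2, habs'.1, habs'.2]

/-! ### Jumps across facet directions -/

section Jump

set_option linter.unusedSectionVars false

variable {d n : ℕ} {C : Type*} [AddCommGroup C] [TopologicalSpace C] [DiscreteTopology C]
    [Finite C] (S : CutProjectScheme d (Space n × C)) {Q : Set (Finset (Space n × ℝ) × C)}

/-- The values that the functional `⟪v, ·⟫` takes on the facets orthogonal to `v`. -/
def facetValues (Q : Set (Finset (Space n × ℝ) × C)) (v : Space n) : Set ℝ :=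
  {β | ∃ p ∈ halfSpaces Q, ∃ c : ℝ, c ≠ 0 ∧ p.1 = c • v ∧ β = p.2 / c}

theorem finite_facetValues (hQ : Q.Finite) {v : Space n} (hv : v ≠ 0) :
    (facetValues Q v).Finite := by
  refine ((finite_halfSpaces hQ).image
    fun p => p.2 / (inner ℝ v p.1 / inner ℝ v v)).subset ?_
  rintro _ ⟨p, hp, c, hc, he, rfl⟩
  refine ⟨p, hp, ?_⟩
  have h0 : (inner ℝ v v : ℝ) ≠ 0 := inner_self_ne_zero.2 hv
  simp only [he, inner_smul_right]
  rw [mul_div_cancel_right₀ _ h0]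

namespace CutProjectScheme

/-- The points of the pattern with parameter `h` whose internal coordinate may lie on a facet of
the window that is orthogonal to `v`. -/
def facetPoints (Q : Set (Finset (Space n × ℝ) × C)) (v : Space n) (h : Space n × C) :
    Set (Space d) :=
  {x | ∃ g, (g, x) ∈ S.lattice ∧ h + g ∈ sided Q 0 ∧ (inner ℝ v (h + g).1 : ℝ) ∈ facetValues Q v}

theorem mem_facetPoints_add {v : Space n} {h g : Space n × C} {x y : Space d}
    (hg : (g, y) ∈ S.lattice) (hx : x ∈ S.facetPoints Q v (h + g)) :
    x + y ∈ S.facetPoints Q v h := by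
  obtain ⟨g', hg', h1, h2⟩ := hx
  rw [add_assoc, add_comm g g'] at h1 h2
  exact ⟨g' + g, S.lattice.add_mem hg' hg, h1, h2⟩

/-- Differences of facet points come from lattice points with internal coordinate at most `r + r` in
norm and with `⟪v, ·⟫` in the finite set of differences of facet values. As `h` cancels,
`exists_slab` gives a width independent of `h`. -/
theorem exists_facetPoints_slab (hQ : Q.Finite) {r : ℝ} (hr : ∀ v ∈ sided Q 0, ‖v.1‖ ≤ r)
    {v : Space n} (hv : v ≠ 0) : ∃ w : Space d, w ≠ 0 ∧ ∃ K : ℝ, ∀ h,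
      ∀ x ∈ S.facetPoints Q v h, ∀ x' ∈ S.facetPoints Q v h, |inner ℝ w (x - x')| ≤ K := by
  have hfin := finite_facetValues hQ hv
  obtain ⟨w, hw, K, hK⟩ := S.exists_slab hv
    ((hfin.prod hfin).image fun b => b.1 - b.2) (r + r)
  refine ⟨w, hw, K, ?_⟩
  rintro h x ⟨g, hg, h1, h2⟩ x' ⟨g', hg', h1', h2'⟩
  have e : (g - g').1 = (h + g).1 - (h + g').1 := by simp
  refine hK (g - g') (x - x') (S.lattice.sub_mem hg hg') ?_
    ⟨(inner ℝ v (h + g).1, inner ℝ v (h + g').1), ⟨h2, h2'⟩, ?_⟩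
  · rw [e]
    exact (norm_sub_le _ _).trans (add_le_add (hr _ h1) (hr _ h1'))
  · simp only
    rw [e, inner_sub_right]

/-- A point can change membership only if a tight half-space sees `u` and `u'` on different sides,
and by assumption the normal of such a half-space is a multiple of `v`. -/
theorem mem_facetPoints_of_not_iff {v : Space n} {u u' : Space n} {h : Space n × C}
    (hsign : ∀ p ∈ halfSpaces Q, p.1 ≠ 0 → (∀ c : ℝ, p.1 ≠ c • v) →
      (inner ℝ p.1 u ≤ (0 : ℝ) ↔ inner ℝ p.1 u' ≤ (0 : ℝ)))
    {x : Space d} (hx : ¬ (x ∈ pattern S.lattice (sided Q u) h ↔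
      x ∈ pattern S.lattice (sided Q u') h)) : x ∈ S.facetPoints Q v h := by
  have main : ∀ (a b : Space n), (∀ p ∈ halfSpaces Q, p.1 ≠ 0 → (∀ c : ℝ, p.1 ≠ c • v) →
      (inner ℝ p.1 a ≤ (0 : ℝ) ↔ inner ℝ p.1 b ≤ (0 : ℝ))) →
      x ∈ pattern S.lattice (sided Q a) h → x ∉ pattern S.lattice (sided Q b) h →
      x ∈ S.facetPoints Q v h := by
    rintro a b hab ⟨g, hg, hgV⟩ hnot
    have hgV' : h + g ∉ sided Q b := fun hmem => hnot ⟨g, hg, hmem⟩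
    obtain ⟨p, hp, hp0, hval, ha, hb⟩ := exists_halfSpace_of_mem_of_notMem hgV hgV'
    obtain ⟨c, hc⟩ : ∃ c : ℝ, p.1 = c • v := by
      by_contra! hcon
      exact absurd ((hab p hp hp0 hcon).1 ha) (not_le.2 hb)
    have hc0 : c ≠ 0 := by
      rintro rfl
      exact hp0 (by rw [hc, zero_smul])
    refine ⟨g, hg, sided_subset a hgV, p, hp, c, hc0, hc, ?_⟩
    rw [hc, inner_smul_left] at hval
    rw [eq_div_iff hc0, mul_comm]
    exact hval
  by_cases h1 : x ∈ pattern S.lattice (sided Q u) h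
  · exact main u u' hsign h1 fun h2 => hx (iff_of_true h1 h2)
  · refine main u' u (fun p hp h0 hc => (hsign p hp h0 hc).symm) ?_ h1
    by_contra h2
    exact hx (iff_of_false h1 h2)

variable {ρ R₀ : ℝ} {g : Set (Space d) → ℝ}

/-- A function with local increments has no jump across a facet direction if the affected points
are far from the origin. -/
theorem exists_forall_far_eq (hΞ : IsPatternFamily (S.sidedPatterns Q) ρ)
    (hg : HasLocalIncrements (S.sidedPatterns Q) g R₀)
    (hU : ∀ η : ℝ, 0 < η → ∃ K : ℝ, ∀ A ∈ S.sidedPatterns Q, ∀ B ∈ S.sidedPatterns Q,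
      AgreeOn K A B → |g A - g B| < η)
    {v : Space n} {w : Space d} (hw : w ≠ 0) {K : ℝ}
    (hK : ∀ h, ∀ x ∈ S.facetPoints Q v h, ∀ x' ∈ S.facetPoints Q v h, |inner ℝ w (x - x')| ≤ K) :
    ∃ R₁ : ℝ, ∀ h u u', IsGeneric Q u → IsGeneric Q u' →
      (∀ p ∈ halfSpaces Q, p.1 ≠ 0 → (∀ c : ℝ, p.1 ≠ c • v) →
        (inner ℝ p.1 u ≤ (0 : ℝ) ↔ inner ℝ p.1 u' ≤ (0 : ℝ))) →
      h ∈ sided Q u → (∀ x ∈ S.facetPoints Q v h, R₁ < |inner ℝ w x|) →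
      h ∈ sided Q u' ∧
        g (pattern S.lattice (sided Q u) h) = g (pattern S.lattice (sided Q u') h) := by
  obtain ⟨R, hR0, hR⟩ := hΞ.exists_sub_eq_of_segment hg
  have hwpos : 0 < ‖w‖ := norm_pos_iff.2 hw
  -- The summand `|K|` exceeds the spread of the slab, so all affected points lie on one side of the
  -- origin; `‖w‖ * R` leaves room for agreement on the ball of radius `R`.
  refine ⟨|K| + ‖w‖ * R, fun h u u' hu hu' hsign hh hfar => ?_⟩
  have hdiff : ∀ x, x ∉ S.facetPoints Q v h → (x ∈ pattern S.lattice (sided Q u) h ↔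
      x ∈ pattern S.lattice (sided Q u') h) := fun x hx => by
    by_contra hcon
    exact hx (S.mem_facetPoints_of_not_iff hsign hcon)
  have h0 : (0 : Space d) ∉ S.facetPoints Q v h := fun h0 => by
    have := hfar 0 h0
    rw [inner_zero_right, abs_zero] at this
    have := abs_nonneg K
    have := mul_nonneg hwpos.le hR0
    linarith
  have hh' : h ∈ sided Q u' := by
    rw [← S.zero_mem_pattern_iff, ← hdiff 0 h0, S.zero_mem_pattern_iff]
    exact hh
  refine ⟨hh', ?_⟩
  have hA : pattern S.lattice (sided Q u) h ∈ S.sidedPatterns Q := ⟨h, u, hu, hh, rfl⟩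
  have hB : pattern S.lattice (sided Q u') h ∈ S.sidedPatterns Q := ⟨h, u', hu', hh', rfl⟩
  set A := pattern S.lattice (sided Q u) h
  set B := pattern S.lattice (sided Q u') h
  -- a unit of sign such that all affected points are on one side
  obtain ⟨σ, hσ, hside⟩ : ∃ σ : ℝ, |σ| = 1 ∧ ∀ x ∈ S.facetPoints Q v h,
      ‖w‖ * R < σ * inner ℝ w x := by
    rcases Set.eq_empty_or_nonempty (S.facetPoints Q v h) with he | ⟨x₀, hx₀⟩
    · exact ⟨1, abs_one, by simp [he]⟩
    have hx₀' := hfar x₀ hx₀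
    have hd : ∀ x ∈ S.facetPoints Q v h, |inner ℝ w x - inner ℝ w x₀| ≤ |K| := fun x hx => by
      rw [← inner_sub_right]
      exact (hK h x hx x₀ hx₀).trans (le_abs_self K)
    rcases le_total 0 (inner ℝ w x₀ : ℝ) with hs | hs
    · rw [abs_of_nonneg hs] at hx₀'
      refine ⟨1, abs_one, fun x hx => ?_⟩
      have := (abs_le.1 (hd x hx)).1
      linarith
    · rw [abs_of_nonpos hs] at hx₀'
      refine ⟨-1, by simp, fun x hx => ?_⟩
      have := (abs_le.1 (hd x hx)).2
      linarith
  -- The origin is moved by `T * ‖w‖` away from the slab, which enlarges the radius of agreement by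
  -- that amount.
  have hagree : ∀ (T K' : ℝ), ‖w‖ * K' - T * ‖w‖ ^ 2 ≤ ‖w‖ * R →
      AgreeOn K' ((-(-(T * σ) • w)) +ᵥ A) ((-(-(T * σ) • w)) +ᵥ B) := by
    intro T K' hT
    refine agreeOn_iff.2 fun x hx => ?_
    rw [mem_vadd_iff, mem_vadd_iff]
    refine hdiff _ fun hmem => ?_
    have h1 := hside _ hmem
    have hσ2 : σ * σ = 1 := by rw [← abs_mul_abs_self, hσ, one_mul]
    have h2 : σ * inner ℝ w (x - -(-(T * σ) • w)) = σ * inner ℝ w x - T * ‖w‖ ^ 2 := by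
      rw [sub_neg_eq_add, inner_add_right, inner_smul_right, real_inner_self_eq_norm_sq]
      linear_combination (-T * ‖w‖ ^ 2) * hσ2
    have h3 : σ * inner ℝ w x ≤ ‖w‖ * K' := by
      refine (le_abs_self _).trans ?_
      rw [abs_mul, hσ, one_mul]
      exact (abs_real_inner_le_norm w x).trans (mul_le_mul_of_nonneg_left hx hwpos.le)
    linarith
  have key : ∀ η : ℝ, 0 < η → |g A - g B| ≤ η := by
    intro η hη
    obtain ⟨K', hK'⟩ := hU η hη
    -- Far enough for agreement on radius `|K'| + |ρ|`; the `|ρ|` is spent on recentring at a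
    -- pattern point `y` near `p`.
    set T := (|K'| + |ρ|) / ‖w‖ with hT
    have hT0 : 0 ≤ T := by positivity
    have hTw : T * ‖w‖ ^ 2 = (|K'| + |ρ|) * ‖w‖ := by
      rw [hT]
      field_simp
    set p : Space d := -(T * σ) • w with hp
    obtain ⟨y, hy, hyp⟩ := hΞ.exists_dist_le A hA p
    have hyp' : dist y p ≤ ρ := by rwa [dist_comm]
    obtain ⟨hyB, he⟩ := hR A hA B hB p (fun t ht0 _ => by
      have := hagree (t * T) R (by
        have : 0 ≤ t * T * ‖w‖ ^ 2 := by positivity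
        linarith)
      convert this using 3 <;>
      · rw [hp, smul_smul]
        congr 2
        ring) y hy hyp'
    rw [← he]
    refine (hK' _ (hΞ.neg_vadd_mem A hA y hy) _ (hΞ.neg_vadd_mem B hB y hyB) ?_).le
    have := hagree T (|K'| + |ρ|) (by
      rw [hTw]
      have := mul_nonneg hwpos.le hR0
      linarith)
    exact this.of_neg_vadd (by linarith [le_abs_self K', le_abs_self ρ])
  refine eq_of_abs_sub_le_all key

/-! ### Passing between generic directions one hyperplane at a time. -/

theorem _root_.le_zero_iff_le_zero_iff_mul_pos {a b : ℝ} (ha : a ≠ 0) (hb : b ≠ 0) :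
    (a ≤ 0 ↔ b ≤ 0) ↔ 0 < a * b := by
  rcases lt_or_gt_of_ne ha with ha | ha <;> rcases lt_or_gt_of_ne hb with hb | hb
  · simp [ha.le, hb.le, mul_pos_of_neg_of_neg ha hb]
  · simp [ha.le, not_le.2 hb, (mul_neg_of_neg_of_pos ha hb).le]
  · simp [hb.le, not_le.2 ha, (mul_neg_of_pos_of_neg ha hb).le]
  · simp [not_le.2 ha, not_le.2 hb, mul_pos ha hb]

theorem _root_.mul_pos_of_mul_pos_of_mul_pos {a b c : ℝ} (hab : 0 < a * b) (hbc : 0 < b * c) :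
    0 < a * c := by
  have hb : 0 < b * b := mul_self_pos.2 (left_ne_zero_of_mul hbc.ne')
  have h : 0 < b * b * (a * c) := by
    have := mul_pos hab hbc
    linarith
  exact pos_of_mul_pos_right h hb.le

theorem _root_.mul_neg_of_mul_neg_of_mul_pos {a b c : ℝ} (hab : a * b < 0) (hbc : 0 < b * c) :
    a * c < 0 := by
  have := mul_pos_of_mul_pos_of_mul_pos (a := -a) (by linarith) hbc
  linarith

/-- A generic direction can be reached from another one by crossing the hyperplanes that separate
them one after the other: this is the first crossing. -/
theorem _root_.exists_isGeneric_first_crossing (hQ : Q.Finite) {u u' : Space n}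
    (hu : IsGeneric Q u) (hu' : IsGeneric Q u')
    (hsep : ∃ p ∈ halfSpaces Q, p.1 ≠ 0 ∧ inner ℝ p.1 u * inner ℝ p.1 u' < (0 : ℝ)) :
    ∃ p₀ ∈ halfSpaces Q, p₀.1 ≠ 0 ∧ inner ℝ p₀.1 u * inner ℝ p₀.1 u' < (0 : ℝ) ∧
      ∃ u₁, IsGeneric Q u₁ ∧ 0 < (inner ℝ p₀.1 u₁ * inner ℝ p₀.1 u' : ℝ) ∧
        ∀ p ∈ halfSpaces Q, p.1 ≠ 0 → (∀ c : ℝ, p.1 ≠ c • p₀.1) →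
          0 < (inner ℝ p.1 u * inner ℝ p.1 u₁ : ℝ) := by
  have hfin := finite_halfSpaces hQ
  set N := halfSpaces Q ∩ {p | p.1 ≠ 0} with hN
  have hNfin : N.Finite := hfin.inter_of_left _
  -- move `u'` inside its chamber so that different hyperplanes are crossed at different times
  have hO : IsOpen {y : Space n | ∀ p ∈ N, 0 < (inner ℝ p.1 u' * inner ℝ p.1 y : ℝ)} := by
    rw [show {y : Space n | ∀ p ∈ N, 0 < (inner ℝ p.1 u' * inner ℝ p.1 y : ℝ)} =
      ⋂ p ∈ N, {y : Space n | 0 < (inner ℝ p.1 u' * inner ℝ p.1 y : ℝ)} by ext; simp]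
    exact hNfin.isOpen_biInter fun p _ => isOpen_lt continuous_const (by fun_prop)
  -- On the segment from `u` to `y`, two hyperplanes crossed at the same time force `y` to be
  -- orthogonal to such a combination of their normals; it is nonzero when the normals are not
  -- parallel.
  obtain ⟨y, hy, hygen⟩ := exists_mem_forall_inner_ne
    (s := (fun q : (Space n × ℝ) × (Space n × ℝ) =>
      ((inner ℝ q.1.1 u : ℝ) • q.2.1 - (inner ℝ q.2.1 u : ℝ) • q.1.1, (0 : ℝ))) ''
        ((N ×ˢ N) ∩ {q | ∀ c : ℝ, q.2.1 ≠ c • q.1.1}))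
    (((hNfin.prod hNfin).inter_of_left _).image _)
    (by
      rintro _ ⟨⟨p, p'⟩, ⟨⟨hp, hp'⟩, hne⟩, rfl⟩ h0
      have h1 : (inner ℝ p.1 u : ℝ) • p'.1 = (inner ℝ p'.1 u : ℝ) • p.1 := sub_eq_zero.1 h0
      have hpu := hu p hp.1 hp.2
      refine hne ((inner ℝ p.1 u : ℝ)⁻¹ * inner ℝ p'.1 u) ?_
      rw [mul_smul, ← h1, inv_smul_smul₀ hpu])
    hO ⟨u', fun p hp => mul_self_pos.2 (hu' p hp.1 hp.2)⟩
  set φ : Space n × ℝ → ℝ → ℝ := fun p t => inner ℝ p.1 u + t * (inner ℝ p.1 y - inner ℝ p.1 u)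
    with hφ
  have hφu : ∀ p t, (inner ℝ p.1 (u + t • (y - u)) : ℝ) = φ p t := fun p t => by
    rw [inner_add_right, inner_smul_right, inner_sub_right]
  set Z := {p | p ∈ N ∧ inner ℝ p.1 u * inner ℝ p.1 y < (0 : ℝ)} with hZ
  have hZfin : Z.Finite := hNfin.subset fun p hp => hp.1
  obtain ⟨p₁, hp₁, hp₁0, hp₁s⟩ := hsep
  -- The time at which the segment from `u` to `y` crosses the hyperplane orthogonal to `p.1`.
  set τ : Space n × ℝ → ℝ := fun p => (inner ℝ p.1 u : ℝ) / (inner ℝ p.1 u - inner ℝ p.1 y) with hτ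
  obtain ⟨p₀, hp₀, hmin⟩ := Set.exists_min_image Z τ hZfin
    ⟨p₁, ⟨hp₁, hp₁0⟩, mul_neg_of_mul_neg_of_mul_pos hp₁s (hy p₁ ⟨hp₁, hp₁0⟩)⟩
  have hZd : ∀ p ∈ Z, 0 < (inner ℝ p.1 u * (inner ℝ p.1 u - inner ℝ p.1 y) : ℝ) := fun p hp => by
    have := mul_self_nonneg (inner ℝ p.1 u : ℝ)
    have := hp.2
    linarith
  have hτmul : ∀ p ∈ Z, τ p * (inner ℝ p.1 u - inner ℝ p.1 y) = inner ℝ p.1 u := fun p hp =>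
    div_mul_cancel₀ _ (right_ne_zero_of_mul (hZd p hp).ne')
  have ht0 : 0 < τ p₀ := by
    have h1 := hZd p₀ hp₀
    have h2 := mul_self_pos.2 (left_ne_zero_of_mul h1.ne')
    have h3 : τ p₀ * (inner ℝ p₀.1 u * (inner ℝ p₀.1 u - inner ℝ p₀.1 y)) =
        inner ℝ p₀.1 u * inner ℝ p₀.1 u := by
      linear_combination inner ℝ p₀.1 u * hτmul p₀ hp₀
    rw [← h3] at h2
    exact pos_of_mul_pos_left h2 h1.le
  have ht1 : τ p₀ < 1 := by
    by_contra! hcon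
    have h1 := hZd p₀ hp₀
    have h3 : τ p₀ * (inner ℝ p₀.1 u * (inner ℝ p₀.1 u - inner ℝ p₀.1 y)) =
        inner ℝ p₀.1 u * inner ℝ p₀.1 u := by
      linear_combination inner ℝ p₀.1 u * hτmul p₀ hp₀
    have h4 := mul_le_mul_of_nonneg_right hcon h1.le
    have := hp₀.2
    linarith
  have hpos : ∀ p ∈ N, (∀ c : ℝ, p.1 ≠ c • p₀.1) → 0 < inner ℝ p.1 u * φ p (τ p₀) := by
    intro p hp hpar
    have hu2 := mul_self_pos.2 (hu p hp.1 hp.2)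
    have e : inner ℝ p.1 u * φ p (τ p₀) = (1 - τ p₀) * (inner ℝ p.1 u * inner ℝ p.1 u) +
        τ p₀ * (inner ℝ p.1 u * inner ℝ p.1 y) := by
      simp only [hφ]
      ring
    by_cases hpZ : inner ℝ p.1 u * inner ℝ p.1 y < (0 : ℝ)
    · have hpZ' : p ∈ Z := ⟨hp, hpZ⟩
      have hlt : τ p₀ < τ p := by
        refine lt_of_le_of_ne (hmin p hpZ') fun heq => ?_
        refine hygen _ ⟨(p₀, p), ⟨⟨hp₀.1, hp⟩, hpar⟩, rfl⟩ ?_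
        simp only
        rw [inner_sub_left, inner_smul_left, inner_smul_left]
        simp only [conj_trivial]
        have h1 := hτmul p hpZ'
        have h2 := hτmul p₀ hp₀
        rw [← heq] at h1
        have h3 : τ p₀ * (inner ℝ p₀.1 u * inner ℝ p.1 y - inner ℝ p.1 u * inner ℝ p₀.1 y) = 0 := by
          linear_combination inner ℝ p.1 u * h2 - inner ℝ p₀.1 u * h1
        exact (mul_eq_zero.1 h3).resolve_left ht0.ne'
      have h4 := mul_lt_mul_of_pos_right hlt (hZd p hpZ')
      have h5 : τ p * (inner ℝ p.1 u * (inner ℝ p.1 u - inner ℝ p.1 y)) =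
          inner ℝ p.1 u * inner ℝ p.1 u := by
        linear_combination inner ℝ p.1 u * hτmul p hpZ'
      rw [e]
      linarith
    · rw [e]
      have h1 := mul_pos (sub_pos.2 ht1) hu2
      have h2 := mul_nonneg ht0.le (not_lt.1 hpZ)
      linarith
  have hev : ∀ᶠ t in 𝓝[>] (τ p₀), ∀ p ∈ N, (∀ c : ℝ, p.1 ≠ c • p₀.1) →
      0 < inner ℝ p.1 u * φ p t := by
    refine (eventually_all_finite hNfin).2 fun p hp => ?_
    by_cases hpar : ∀ c : ℝ, p.1 ≠ c • p₀.1
    · have hc : Continuous fun t => inner ℝ p.1 u * φ p t := by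
        simp only [hφ]
        fun_prop
      exact nhdsWithin_le_nhds (((hc.tendsto _).eventually_const_lt (hpos p hp hpar)).mono
        fun t ht _ => ht)
    · exact Eventually.of_forall fun t h => absurd h hpar
  -- Just after the first crossing: the hyperplanes parallel to that of `p₀` have been crossed, and
  -- no others.
  obtain ⟨t, ht, htlt⟩ := (hev.and self_mem_nhdsWithin).exists
  have hφ0 : 0 < φ p₀ t * inner ℝ p₀.1 y := by
    have h1 : φ p₀ t * inner ℝ p₀.1 y =
        (t - τ p₀) * (inner ℝ p₀.1 y * inner ℝ p₀.1 y - inner ℝ p₀.1 u * inner ℝ p₀.1 y) := by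
      simp only [hφ]
      linear_combination -inner ℝ p₀.1 y * hτmul p₀ hp₀
    rw [h1]
    refine mul_pos (sub_pos.2 htlt) ?_
    have := mul_self_nonneg (inner ℝ p₀.1 y : ℝ)
    have := hp₀.2
    linarith
  have hyu' := hy p₀ hp₀.1
  rw [mul_comm] at hyu'
  refine ⟨p₀, hp₀.1.1, hp₀.1.2, mul_neg_of_mul_neg_of_mul_pos hp₀.2 hyu', u + t • (y - u),
    fun p hp hp0 => ?_, ?_, fun p hp hp0 hpar => ?_⟩
  · rw [hφu]
    by_cases hpar : ∀ c : ℝ, p.1 ≠ c • p₀.1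
    · exact right_ne_zero_of_mul (ht p ⟨hp, hp0⟩ hpar).ne'
    · push Not at hpar
      obtain ⟨c, hc⟩ := hpar
      rw [← hφu, hc, inner_smul_left, hφu]
      refine mul_ne_zero ?_ (left_ne_zero_of_mul hφ0.ne')
      rintro h0
      simp only [conj_trivial] at h0
      exact hp0 (by rw [hc, h0, zero_smul])
  · rw [hφu]
    exact mul_pos_of_mul_pos_of_mul_pos hφ0 hyu'
  · rw [hφu]
    exact ht p ⟨hp, hp0⟩ hpar

/-- If all affected points are far from the origin, the value of a function that only jumps when
they are near does not depend on the direction. -/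
theorem eq_of_forall_far (hQ : Q.Finite) {w : Space n → Space d} {R₁ : Space n → ℝ}
    (hjump : ∀ p₀ ∈ halfSpaces Q, p₀.1 ≠ 0 → ∀ h u u', IsGeneric Q u → IsGeneric Q u' →
      (∀ p ∈ halfSpaces Q, p.1 ≠ 0 → (∀ c : ℝ, p.1 ≠ c • p₀.1) →
        (inner ℝ p.1 u ≤ (0 : ℝ) ↔ inner ℝ p.1 u' ≤ (0 : ℝ))) →
      h ∈ sided Q u → (∀ x ∈ S.facetPoints Q p₀.1 h, R₁ p₀.1 < |inner ℝ (w p₀.1) x|) →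
      h ∈ sided Q u' ∧
        g (pattern S.lattice (sided Q u) h) = g (pattern S.lattice (sided Q u') h))
    {h : Space n × C} (hfar : ∀ p ∈ halfSpaces Q, p.1 ≠ 0 →
      ∀ x ∈ S.facetPoints Q p.1 h, R₁ p.1 < |inner ℝ (w p.1) x|)
    {u u' : Space n} (hu : IsGeneric Q u) (hu' : IsGeneric Q u') (hh : h ∈ sided Q u) :
    g (pattern S.lattice (sided Q u) h) = g (pattern S.lattice (sided Q u') h) := by
  have hfin : ∀ y : Space n, {p | p ∈ halfSpaces Q ∧ p.1 ≠ 0 ∧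
      inner ℝ p.1 y * inner ℝ p.1 u' < (0 : ℝ)}.Finite := fun y =>
    (finite_halfSpaces hQ).subset fun p hp => hp.1
  -- Induction on the number of half-spaces separating `u` from `u'`.
  generalize hN : {p | p ∈ halfSpaces Q ∧ p.1 ≠ 0 ∧
    inner ℝ p.1 u * inner ℝ p.1 u' < (0 : ℝ)}.ncard = N
  induction N using Nat.strong_induction_on generalizing u with
  | _ N ih =>
    by_cases hsep : ∃ p ∈ halfSpaces Q, p.1 ≠ 0 ∧ inner ℝ p.1 u * inner ℝ p.1 u' < (0 : ℝ)
    · obtain ⟨p₀, hp₀, hp₀0, hp₀s, u₁, hu₁, h1, h2⟩ :=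
        exists_isGeneric_first_crossing hQ hu hu' hsep
      obtain ⟨hh₁, he⟩ := hjump p₀ hp₀ hp₀0 h u u₁ hu hu₁
        (fun p hp hp0 hpar => (le_zero_iff_le_zero_iff_mul_pos (hu p hp hp0) (hu₁ p hp hp0)).2
          (h2 p hp hp0 hpar)) hh (hfar p₀ hp₀ hp₀0)
      rw [he]
      refine ih _ ?_ hu₁ hh₁ rfl
      rw [← hN]
      -- Normals not parallel to `p₀.1` see `u₁` as they see `u`; parallel ones no longer separate,
      -- since their product is that of `p₀` times a square. And `p₀` itself drops out.
      refine Set.ncard_lt_ncard (Set.ssubset_iff_subset_ne.2 ⟨?_, fun heq => ?_⟩) (hfin u)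
      · rintro p ⟨hp, hp0, hs⟩
        refine ⟨hp, hp0, ?_⟩
        by_cases hpar : ∀ c : ℝ, p.1 ≠ c • p₀.1
        · have h3 := h2 p hp hp0 hpar
          rw [mul_comm] at h3 hs ⊢
          exact mul_neg_of_mul_neg_of_mul_pos hs h3
        · push Not at hpar
          obtain ⟨c, hc⟩ := hpar
          rw [hc, inner_smul_left, inner_smul_left] at hs
          simp only [conj_trivial] at hs
          have h4 := mul_nonneg (mul_self_nonneg c) h1.le
          linarith
      · have hmem : p₀ ∈ {p | p ∈ halfSpaces Q ∧ p.1 ≠ 0 ∧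
            inner ℝ p.1 u₁ * inner ℝ p.1 u' < (0 : ℝ)} := heq ▸ ⟨hp₀, hp₀0, hp₀s⟩
        exact lt_asymm hmem.2.2 h1
    · push Not at hsep
      rw [sided_eq_of_sign fun p hp hp0 =>
        (le_zero_iff_le_zero_iff_mul_pos (hu p hp hp0) (hu' p hp hp0)).2 <|
          lt_of_le_of_ne (hsep p hp hp0) (mul_ne_zero (hu p hp hp0) (hu' p hp hp0)).symm]

/-- There is a bounded set of points, one of which is far from all affected points. -/
theorem exists_far_point (hQ : Q.Finite) {w : Space n → Space d} {K : Space n → ℝ}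
    (hw : ∀ p ∈ halfSpaces Q, p.1 ≠ 0 → w p.1 ≠ 0)
    (hK : ∀ p ∈ halfSpaces Q, p.1 ≠ 0 → ∀ h, ∀ x ∈ S.facetPoints Q p.1 h,
      ∀ x' ∈ S.facetPoints Q p.1 h, |inner ℝ (w p.1) (x - x')| ≤ K p.1) (R : Space n → ℝ) :
    ∃ L : ℝ, ∀ h, ∃ z : Space d, ‖z‖ ≤ L ∧ ∀ p ∈ halfSpaces Q, p.1 ≠ 0 →
      ∀ x ∈ S.facetPoints Q p.1 h, R p.1 < |inner ℝ (w p.1) (x - z)| := by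
  have hfin : (halfSpaces Q ∩ {p | p.1 ≠ 0}).Finite := (finite_halfSpaces hQ).inter_of_left _
  -- A line in direction `e` is transversal to all slabs.
  obtain ⟨e, -, he⟩ := exists_mem_forall_inner_ne
    (s := (fun p : Space n × ℝ => (w p.1, (0 : ℝ))) '' (halfSpaces Q ∩ {p | p.1 ≠ 0}))
    (hfin.image _) (by rintro _ ⟨p, hp, rfl⟩; exact hw p hp.1 hp.2) isOpen_univ Set.univ_nonempty
  -- Steps of length `|T|` along `e` move `⟪w p.1, ·⟫` by more than the width of any forbidden zone,
  -- which is at most `2 * |R p.1| + |K p.1|`.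
  obtain ⟨T, hT⟩ := (hfin.image fun p =>
    (2 * |R p.1| + |K p.1| + 1) / |inner ℝ (w p.1) e|).bddAbove
  set m := hfin.toFinset.card
  refine ⟨m * (|T| * ‖e‖), fun h => ?_⟩
  by_contra! hcon
  -- There are `m + 1` candidates for `m` half-spaces: if all failed, two would fail for the same
  -- half-space, though they are too far apart for that.
  have hbad : ∀ j ∈ Finset.range (m + 1), ∃ p, p ∈ hfin.toFinset ∧
      ∃ x ∈ S.facetPoints Q p.1 h, |inner ℝ (w p.1) (x - ((j : ℝ) * |T|) • e)| ≤ R p.1 := by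
    intro j hj
    obtain ⟨p, hp, hp0, hx⟩ := hcon (((j : ℝ) * |T|) • e) (by
      rw [norm_smul, Real.norm_of_nonneg (by positivity), mul_assoc]
      refine mul_le_mul_of_nonneg_right ?_ (by positivity)
      exact_mod_cast Nat.lt_succ_iff.1 (Finset.mem_range.1 hj))
    exact ⟨p, hfin.mem_toFinset.2 ⟨hp, hp0⟩, hx⟩
  choose! f hf hfx using hbad
  obtain ⟨i, hi, j, hj, hij, hfij⟩ := Finset.exists_ne_map_eq_of_card_lt_of_maps_to
    (s := Finset.range (m + 1)) (t := hfin.toFinset) (by simp [m]) hf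
  obtain ⟨x, hx, hxi⟩ := hfx i hi
  obtain ⟨x', hx', hxj⟩ := hfx j hj
  rw [← hfij] at hx' hxj
  have hp := hfin.mem_toFinset.1 (hf i hi)
  set p := f i
  have h1 := hK p hp.1 hp.2 h x hx x' hx'
  have hne : (inner ℝ (w p.1) e : ℝ) ≠ 0 := he _ ⟨p, hp, rfl⟩
  have hpos : 0 < |(inner ℝ (w p.1) e : ℝ)| := abs_pos.2 hne
  have h2 : 2 * |R p.1| + |K p.1| + 1 ≤ |T| * |inner ℝ (w p.1) e| := by
    rw [← div_le_iff₀ hpos]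
    exact (hT ⟨p, hp, rfl⟩).trans (le_abs_self T)
  rw [inner_sub_right, inner_smul_right] at hxi hxj
  rw [inner_sub_right] at h1
  have h3 : |((i : ℝ) - j) * (|T| * inner ℝ (w p.1) e)| ≤ 2 * |R p.1| + |K p.1| := by
    have a1 := abs_le.1 (hxi.trans (le_abs_self _))
    have a2 := abs_le.1 (hxj.trans (le_abs_self _))
    have a3 := abs_le.1 (h1.trans (le_abs_self _))
    rw [abs_le]
    constructor <;> linarith [a1.1, a1.2, a2.1, a2.2, a3.1, a3.2]
  have h4 : (1 : ℝ) ≤ |(i : ℝ) - j| := by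
    have : (1 : ℤ) ≤ |(i : ℤ) - j| := Int.one_le_abs (sub_ne_zero.2 (by exact_mod_cast hij))
    exact_mod_cast this
  rw [abs_mul, abs_mul, abs_abs] at h3
  have h5 := mul_le_mul_of_nonneg_right h4 (mul_nonneg (abs_nonneg T) hpos.le)
  linarith

end CutProjectScheme

end Jump

/-! ### Assembling the proof. -/

theorem theorem5 {d n : ℕ} {C : Type*} [AddCommGroup C] [TopologicalSpace C] [DiscreteTopology C]
    [Finite C] (S : CutProjectScheme d (Space n × C)) (W : Set (Space n × C))
    (hW : IsWindow W) (hpoly : IsPolyhedral W)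
    (M : Set (Space d)) (hM : S.IsModelSet W M)
    (F : M → ℝ) (hF : WeaklyPatternEquivariant M F)
    (hδ : StronglyPatternEquivariantOnEdges M (coboundary F)) :
    Nonslip M F := by
  obtain ⟨Q, hQ, rfl⟩ := hpoly.exists_sided
  obtain ⟨G, hG⟩ := hF
  obtain ⟨r, hr⟩ : ∃ r, ∀ v ∈ sided Q 0, ‖v.1‖ ≤ r :=
    hW.isCompact.exists_bound_of_continuousOn continuous_fst.continuousOn
  obtain ⟨ξ, hξ⟩ := CutProjectScheme.IsModelSet.exists_mem_torusGraph S hW.isCompact hM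
  have htr := CutProjectScheme.IsModelSet.transversal_eq S hQ hW hM
  have hcomp := CutProjectScheme.IsModelSet.isCompact_transversal S hW.isCompact hM
  have hint : (interior (sided Q 0)).Nonempty := by
    rw [← closure_nonempty_iff, hW.closure_interior]
    exact hW.nonempty
  obtain ⟨ρ, hρ⟩ := S.exists_dist_pattern_le isOpen_interior hint
  have hb : ∀ B ∈ {A | ∃ x ∈ M, A = (-x) +ᵥ M}, B ⊆ S.boundedPoints (r + r) := by
    rintro _ ⟨m, hm, rfl⟩
    exact S.neg_vadd_subset_boundedPoints hr hξ hm
  have hΞ : IsPatternFamily (S.sidedPatterns Q) ρ :=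
    { zero_mem := fun A hA => S.zero_mem_of_mem_sidedPatterns hA
      neg_vadd_mem := fun A hA y hy => S.neg_vadd_mem_sidedPatterns hA hy
      finite := fun A hA K => (S.finite_boundedPoints_inter (r + r) K).subset
        (Set.inter_subset_inter_left _
          (S.subset_boundedPoints_of_mem_closure hb (show A ∈ transversal M by rwa [htr])))
      exists_dist_le := by
        rintro _ ⟨h, u, -, -, rfl⟩ c
        obtain ⟨x, ⟨g, hg, hgV⟩, hx⟩ := hρ h c
        exact ⟨x, ⟨g, hg, interior_subset_sided hQ u hgV⟩, hx⟩ }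
  have happ : ∀ A ∈ transversal M, ∀ K : ℝ, ∃ m ∈ M, AgreeOn K A ((-m) +ᵥ M) := fun A hA K => by
    obtain ⟨_, ⟨m, hm, rfl⟩, h⟩ := S.exists_agreeOn_of_mem_closure hb hA K
    exact ⟨m, hm, h⟩
  obtain ⟨R₀, hg⟩ := exists_hasLocalIncrements (htr ▸ hΞ) happ hcomp hG hδ
  have hU : ∀ η : ℝ, 0 < η → ∃ K : ℝ, ∀ A ∈ transversal M, ∀ B ∈ transversal M, AgreeOn K A B →
      |transversalExtend G A - transversalExtend G B| < η := fun η hη =>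
    exists_abs_transversalExtend_sub_lt hcomp hG.1 hη
  rw [htr] at hg hU
  have hslab : ∀ v : Space n, ∃ (w : Space d) (K R₁ : ℝ), v ≠ 0 → w ≠ 0 ∧
      (∀ h, ∀ x ∈ S.facetPoints Q v h, ∀ x' ∈ S.facetPoints Q v h, |inner ℝ w (x - x')| ≤ K) ∧
      ∀ h u u', IsGeneric Q u → IsGeneric Q u' →
        (∀ p ∈ halfSpaces Q, p.1 ≠ 0 → (∀ c : ℝ, p.1 ≠ c • v) →
          (inner ℝ p.1 u ≤ (0 : ℝ) ↔ inner ℝ p.1 u' ≤ (0 : ℝ))) →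
        h ∈ sided Q u → (∀ x ∈ S.facetPoints Q v h, R₁ < |inner ℝ w x|) →
        h ∈ sided Q u' ∧ transversalExtend G (pattern S.lattice (sided Q u) h) =
          transversalExtend G (pattern S.lattice (sided Q u') h) := by
    intro v
    by_cases hv : v = 0
    · exact ⟨0, 0, 0, fun h => absurd hv h⟩
    obtain ⟨w, hw, K, hK⟩ := S.exists_facetPoints_slab hQ hr hv
    obtain ⟨R₁, hR₁⟩ := S.exists_forall_far_eq hΞ hg hU hw hK
    exact ⟨w, K, R₁, fun _ => ⟨hw, hK, hR₁⟩⟩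
  choose w K R₁ hwK using hslab
  -- The margin `‖w v‖ * ρ` is lost when the far point is replaced by a pattern point within `ρ` of
  -- it.
  obtain ⟨L, hL⟩ := S.exists_far_point hQ (w := w) (K := K) (fun p _ h0 => (hwK p.1 h0).1)
    (fun p _ h0 => (hwK p.1 h0).2.1) (fun v => R₁ v + ‖w v‖ * ρ)
  obtain ⟨R, hR0, hR⟩ := hΞ.exists_sub_eq_of_segment hg
  -- Agreement on radius `R + |L| + 1` gives agreement on radius `R` around every point of the
  -- segment from the origin to a point `z` with `‖z‖ ≤ L`.
  refine ⟨G, hG, (R + |L| + 1)⁻¹, by positivity, fun Λ₁ Λ₂ hrel hag => ?_⟩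
  rw [inv_inv] at hag
  rw [← transversalExtend_apply G Λ₁, ← transversalExtend_apply G Λ₂]
  obtain ⟨A, hA⟩ := Λ₁
  obtain ⟨B, hB⟩ := Λ₂
  simp only at hrel hag ⊢
  rw [htr] at hA hB
  obtain ⟨h, u, hu, hh, hAeq⟩ := hA
  obtain ⟨h', u', hu', hh', hBeq⟩ := id hB
  have hpar := S.eq_of_maxEquicontinuousRel hW hξ
    (CutProjectScheme.IsModelSet.exists_mem_hull_mem_torusGraph S hQ hW hM)
    (hAeq ▸ S.pattern_mem_torusGraph (sided_subset u) (interior_subset_sided hQ u) h)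
    (hBeq ▸ S.pattern_mem_torusGraph (sided_subset u') (interior_subset_sided hQ u') h') hrel
  -- Only the directions `u` and `u'` can now differ.
  obtain rfl := S.eq_of_mk_eq hpar
  have hA : A ∈ S.sidedPatterns Q := ⟨h, u, hu, hh, hAeq⟩
  obtain ⟨z, hzL, hz⟩ := hL h
  obtain ⟨y, hy, hzy⟩ := hΞ.exists_dist_le A hA z
  obtain ⟨hyB, he⟩ := hR A hA B hB z (fun t ht0 ht1 => hag.vadd (by
    rw [norm_neg, norm_smul, Real.norm_of_nonneg ht0]
    have := mul_le_of_le_one_left (norm_nonneg z) ht1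
    linarith [le_abs_self L])) y hy (by rwa [dist_comm])
  obtain ⟨g, hgy, hgu⟩ : ∃ g, (g, y) ∈ S.lattice ∧ h + g ∈ sided Q u := by rwa [hAeq] at hy
  have hfar : ∀ p ∈ halfSpaces Q, p.1 ≠ 0 → ∀ x ∈ S.facetPoints Q p.1 (h + g),
      R₁ p.1 < |inner ℝ (w p.1) x| := by
    intro p hp hp0 x hx
    have h1 := hz p hp hp0 _ (S.mem_facetPoints_add hgy hx)
    have e : x + y - z = x - (z - y) := by abel
    rw [e, inner_sub_right] at h1
    have h2 := abs_sub (inner ℝ (w p.1) x) (inner ℝ (w p.1) (z - y))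
    have h3 := (abs_real_inner_le_norm (w p.1) (z - y)).trans
      (mul_le_mul_of_nonneg_left ((dist_eq_norm z y) ▸ hzy) (norm_nonneg _))
    linarith
  -- Seen from `y` all slabs are far, so the two patterns have the same value there; `he` carries
  -- this equality back to the origin.
  have hfin := S.eq_of_forall_far hQ (g := transversalExtend G) (w := w) (R₁ := R₁)
    (fun p _ h0 => (hwK p.1 h0).2.2) hfar hu hu' hgu
  rw [hAeq, hBeq, S.neg_vadd_pattern hgy, S.neg_vadd_pattern hgy, hfin, sub_self] at he
  rw [hAeq, hBeq]
  exact (sub_eq_zero.1 he.symm)
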